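/- Let $\mathit{Intv}$ be the set of non-empty intervals of $\mathbb{R}_{\ge 0}$ with endpoints in $\mathbb{N}\cup\{\infty\}$, and let $\mathit{Intv}_{(0,\infty)}$ be the set of those $I\in\mathit{Intv}$ that are unbounded or are left-closed with left endpoint $0$ (i.e. of the form $[0,n]$ or $[0,n[$ if bounded). A *state variable* is a triple $x=(V_x,T_x,D_x)$ with $V_x$ a finite set of values, $T_x:V_x\to 2^{V_x}$ and $D_x:V_x\to\mathit{Intv}$. A *timeline* for $x$ is a non-empty finite sequence $\pi=(v_0,d_0)\cdots(v_n,d_n)$ of tokens with $v_i\in V_x$, $d_i\in D_x(v_i)$ for $0\le i\le n$, and $v_{i+1}\in T_x(v_i)$ for $0\le i<n$. Its $i$-th token has start time $\mathsf{s}(\pi,i)=\sum_{h<i}d_h$ and end time $\mathsf{e}(\pi,i)=\sum_{h\le i}d_h$. A *multi-timeline* $\Pi$ of a finite set $SV$ of state variables assigns to each $x\in SV$ a timeline $\Pi(x)$ for $x$. Fix an infinite set $\Sigma$ of token names. An *atom* is an expression $o_1\le^{e_1,e_2}_I o_2$, $o\le^{e}_I n$ or $n\le^{e}_I o$ with $o,o_1,o_2\in\Sigma$,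 $e,e_1,e_2\in\{\mathsf{s},\mathsf{e}\}$, $I\in\mathit{Intv}$, $n\in\mathbb{N}$. For a map $\lambda$ from $\Sigma$ to the tokens (pairs of a timeline and a position) of $\Pi$, these atoms are satisfied iff $e_2(\lambda(o_2))-e_1(\lambda(o_1))\in I$, $n-e(\lambda(o))\in I$, and $e(\lambda(o))-n\in I$, respectively. An *existential statement* is $\mathcal{E}=\exists o_1[x_1=v_1]\cdots\exists o_n[x_n=v_n].\,\mathcal{C}$ with $\mathcal{C}$ a conjunction of atoms, $o_i\in\Sigma$, $x_i\in SV$ and $v_i\in V_{x_i}$; $\lambda$ satisfies $\mathcal{E}$ if for each $i$, $\lambda(o_i)$ is a token of $\Pi(x_i)$ with value $v_i$, and $\lambda$ satisfies all atoms of $\mathcal{C}$. A *synchronization rule* is a trigger-less rule $\top\to\mathcal{E}_1\vee\dots\vee\mathcal{E}_k$ or a trigger rule $o_0[x_0=v_0]\to\mathcal{E}_1\vee\dots\vee\mathcal{E}_k$ ($k\ge 1$, $x_0\in SV$, $v_0\in V_{x_0}$); every token name used in an atom of some $\mathcal{E}_i$ must be quantified in $\mathcal{E}_i$ or, in a trigger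 rule, be $o_0$. $\Pi$ satisfies the trigger-less rule if some $\lambda$ satisfies some $\mathcal{E}_i$. $\Pi$ satisfies the trigger rule *under the future semantics* if for each token of $\Pi(x_0)$ with value $v_0$ there are an $\mathcal{E}_i$ and a $\lambda$ satisfying $\mathcal{E}_i$ such that $\lambda(o_0)$ is that token and $\mathsf{s}(\lambda(o))\ge\mathsf{s}(\lambda(o_0))$ for every name $o$ quantified in $\mathcal{E}_i$. A *TP domain* $P=(SV,R)$ consists of a finite set $SV$ of state variables and a finite set $R$ of synchronization rules for $SV$. A *future plan* of $P$ is a multi-timeline of $SV$ satisfying all trigger-less rules of $R$, and all trigger rules of $R$ under the future semantics. The *future TP problem* asks, given a TP domain $P$, whether $P$ has a future plan. **Theorem 1.** The future TP problem is undecidable. It remains undecidable when the input is restricted to TP domains with exactly one state variable in which all intervals (the values of the constraint function $D_x$ and the intervals in atoms) belong to $\mathit{Intv}_{(0,\infty)}$. -/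

import Mathlib

namespace TP

/-! ## Syntax -/

/-- An interval of non-negative reals with left endpoint `lo : ℕ` and right endpoint in `ℕ ∪ {∞}`
(`none` is `∞`); the flags tell whether the endpoints belong to the interval. -/
structure Intv where
  lo : ℕ
  loClosed : Bool
  hi : Option (ℕ × Bool)

/-- The set of reals denoted by an interval. -/
def Intv.toSet (I : Intv) : Set ℝ :=
  {r | (if I.loClosed then (I.lo : ℝ) ≤ r else (I.lo : ℝ) < r) ∧
    ∀ n c, I.hi = some (n, c) → if c then r ≤ (n : ℝ) else r < (n : ℝ)}

/-- The class of intervals that are unbounded, or left-closed with left endpoint `0`. -/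
def Intv.IsZeroInf (I : Intv) : Prop :=
  I.hi = none ∨ (I.lo = 0 ∧ I.loClosed = true)

/-- The interval `[0, ∞[`. -/
def Intv.nonneg : Intv := ⟨0, true, none⟩

/-- A state variable `(V, T, D)`. Its values are `V = {0, …, constr.length - 1}`, the constraint
function is `D v = constr[v]`, and `w ∈ T v` iff `(v, w) ∈ trans`. -/
structure StateVar where
  constr : List Intv
  trans : List (ℕ × ℕ)

/-- Start or end of a token. -/
inductive Event
  | start
  | finish

/-- Atoms; token names are natural numbers.
* `interval o₁ e₁ I o₂ e₂` is `o₁ ≤^{e₁,e₂}_I o₂`;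
* `before o e I n` is `o ≤^e_I n`;
* `after n I o e` is `n ≤^e_I o`. -/
inductive Atom
  | interval (o₁ : ℕ) (e₁ : Event) (I : Intv) (o₂ : ℕ) (e₂ : Event)
  | before (o : ℕ) (e : Event) (I : Intv) (n : ℕ)
  | after (n : ℕ) (I : Intv) (o : ℕ) (e : Event)

/-- A quantifier `o[x = v]`; `var` is the index of the state variable `x`. -/
structure Quantifier where
  name : ℕ
  var : ℕ
  val : ℕ

/-- An existential statement `∃ o₁[x₁ = v₁] ⋯ ∃ oₙ[xₙ = vₙ]. C` with `C` a conjunction of atoms. -/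
structure ExStmt where
  quants : List Quantifier
  atoms : List Atom

/-- A synchronization rule: `trigger = some q` is the trigger rule `q → E₁ ∨ ⋯ ∨ Eₖ`,
and `trigger = none` is the trigger-less rule `⊤ → E₁ ∨ ⋯ ∨ Eₖ`. -/
structure Rule where
  trigger : Option Quantifier
  stmts : List ExStmt

/-- A domain `(SV, R)`: finitely many state variables and finitely many rules.
State variables are referred to by their position in `vars`. -/
structure Domain where
  vars : List StateVar
  rules : List Rule

/-! ## Well-formedness -/

/-- The interval in an atom. -/
def Atom.intv : Atom → Intv
  | .interval _ _ I _ _ => I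
  | .before _ _ I _ => I
  | .after _ I _ _ => I

/-- The token names in an atom. -/
def Atom.names : Atom → List ℕ
  | .interval o₁ _ _ o₂ _ => [o₁, o₂]
  | .before o _ _ _ => [o]
  | .after _ _ o _ => [o]

/-- Token name `o` is free in `E`: it is used in an atom, but occurs in no quantifier. -/
def ExStmt.IsFree (E : ExStmt) (o : ℕ) : Prop :=
  (∃ a ∈ E.atoms, o ∈ a.names) ∧ ∀ q ∈ E.quants, q.name ≠ o

/-- All transitions are between values of the variable. -/
def StateVar.WellFormed (x : StateVar) : Prop :=
  ∀ p ∈ x.trans, p.1 < x.constr.length ∧ p.2 < x.constr.length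

/-- A quantifier refers to a state variable of the domain and to one of its values. -/
def Quantifier.WellFormed (vars : List StateVar) (q : Quantifier) : Prop :=
  ∃ x, vars[q.var]? = some x ∧ q.val < x.constr.length

def Rule.WellFormed (vars : List StateVar) (R : Rule) : Prop :=
  (∀ q, R.trigger = some q → q.WellFormed vars) ∧
  R.stmts ≠ [] ∧
  ∀ E ∈ R.stmts, (∀ q ∈ E.quants, q.WellFormed vars) ∧
    ∀ o, E.IsFree o → ∃ q, R.trigger = some q ∧ q.name = o

/-- `I` occurs in the domain, as a constraint on durations or in an atom of a rule. -/
def Domain.HasIntv (P : Domain) (I : Intv) : Prop :=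
  (∃ x ∈ P.vars, I ∈ x.constr) ∨
  ∃ R ∈ P.rules, ∃ E ∈ R.stmts, ∃ a ∈ E.atoms, a.intv = I

def Domain.WellFormed (P : Domain) : Prop :=
  (∀ x ∈ P.vars, x.WellFormed) ∧ (∀ R ∈ P.rules, R.WellFormed P.vars) ∧
  ∀ I, P.HasIntv I → I.toSet.Nonempty

/-! ## Semantics -/

/-- A token: a value together with a duration. -/
structure Token where
  val : ℕ
  dur : ℝ

/-- `t` is a token for the state variable `x`. -/
def StateVar.IsToken (x : StateVar) (t : Token) : Prop :=
  ∃ I, x.constr[t.val]? = some I ∧ t.dur ∈ I.toSet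

/-- `π` is a timeline for the state variable `x`. -/
def StateVar.IsTimeline (x : StateVar) (π : List Token) : Prop :=
  π ≠ [] ∧ (∀ t ∈ π, x.IsToken t) ∧ π.IsChain fun t t' => (t.val, t'.val) ∈ x.trans

/-- The time of an event of the `i`-th token of `π`: the start time is the sum of the durations of
the previous tokens, the end time includes the duration of the `i`-th token. -/
def eventTime (π : List Token) (i : ℕ) : Event → ℝ
  | .start => ((π.take i).map Token.dur).sum
  | .finish => ((π.take (i + 1)).map Token.dur).sum

/-- A family of token sequences, one for each of `k` state variables. -/
abbrev Multi (k : ℕ) := Fin k → List Token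

/-- A multi-timeline of the state variables `vars`. -/
def IsMultiTimeline (vars : List StateVar) (M : Multi vars.length) : Prop :=
  ∀ j : Fin vars.length, (vars.get j).IsTimeline (M j)

/-- An assignment of a token (timeline index and position) of `M` to every token name. -/
def Assignment {k : ℕ} (M : Multi k) := ℕ → (j : Fin k) × Fin (M j).length



/-- The time of event `e` of the token assigned to `o`. -/
def Assignment.time {k : ℕ} {M : Multi k} (lam : Assignment M) (o : ℕ) (e : Event) : ℝ :=
  eventTime (M (lam o).1) (lam o).2 e

def Assignment.SatAtom {k : ℕ} {M : Multi k} (lam : Assignment M) : Atom → Prop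
  | .interval o₁ e₁ I o₂ e₂ => lam.time o₂ e₂ - lam.time o₁ e₁ ∈ I.toSet
  | .before o e I n => (n : ℝ) - lam.time o e ∈ I.toSet
  | .after n I o e => lam.time o e - (n : ℝ) ∈ I.toSet

/-- The token assigned to the name of `q` belongs to the timeline of the variable of `q` and has
the value of `q`. -/
def Assignment.SatQuant {k : ℕ} {M : Multi k} (lam : Assignment M) (q : Quantifier) : Prop :=
  ((lam q.name).1 : ℕ) = q.var ∧ ((M (lam q.name).1).get (lam q.name).2).val = q.val

/-- `lam` is consistent with `E` and satisfies all of its atoms. -/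
def Assignment.SatStmt {k : ℕ} {M : Multi k} (lam : Assignment M) (E : ExStmt) : Prop :=
  (∀ q ∈ E.quants, lam.SatQuant q) ∧ ∀ a ∈ E.atoms, lam.SatAtom a

/-- Satisfaction of a synchronization rule (standard semantics). -/
def SatRule {k : ℕ} (M : Multi k) (R : Rule) : Prop :=
  match R.trigger with
  | none => ∃ E ∈ R.stmts, ∃ lam : Assignment M, lam.SatStmt E
  | some q => ∀ (j : Fin k) (i : Fin (M j).length), (j : ℕ) = q.var → ((M j).get i).val = q.val →
      ∃ E ∈ R.stmts, ∃ lam : Assignment M, lam q.name = ⟨j, i⟩ ∧ lam.SatStmt E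

/-- Add to `E` the atoms `o₀ ≤^{s,s}_{[0,∞[} oᵢ` for all quantified names `oᵢ`. -/
def ExStmt.future (o₀ : ℕ) (E : ExStmt) : ExStmt :=
  ⟨E.quants, E.atoms ++ E.quants.map fun q => .interval o₀ .start .nonneg q.name .start⟩

/-- Encode the future semantics in the rule; trigger-less rules are unchanged. -/
def Rule.future (R : Rule) : Rule :=
  match R.trigger with
  | none => R
  | some q => ⟨some q, R.stmts.map (ExStmt.future q.name)⟩

/-- `M` is a future plan of `P`. -/
def Domain.IsFuturePlan (P : Domain) (M : Multi P.vars.length) : Prop :=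
  IsMultiTimeline P.vars M ∧ ∀ R ∈ P.rules, SatRule M R.future

/-- The question of the future planning problem: `P` has a future plan. -/
def Domain.HasFuturePlan (P : Domain) : Prop := ∃ M, P.IsFuturePlan M

/-! ## Domains as inputs of algorithms -/

def Intv.equiv : Intv ≃ ℕ × Bool × Option (ℕ × Bool) where
  toFun I := (I.lo, I.loClosed, I.hi)
  invFun p := ⟨p.1, p.2.1, p.2.2⟩
  left_inv _ := rfl
  right_inv _ := rfl

instance : Primcodable Intv := Primcodable.ofEquiv _ Intv.equiv

def StateVar.equiv : StateVar ≃ List Intv × List (ℕ × ℕ) where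
  toFun x := (x.constr, x.trans)
  invFun p := ⟨p.1, p.2⟩
  left_inv _ := rfl
  right_inv _ := rfl

instance : Primcodable StateVar := Primcodable.ofEquiv _ StateVar.equiv

def Event.equiv : Event ≃ Bool where
  toFun | .start => false | .finish => true
  invFun | false => .start | true => .finish
  left_inv x := by cases x <;> rfl
  right_inv x := by cases x <;> rfl

instance : Primcodable Event := Primcodable.ofEquiv _ Event.equiv

def Atom.equiv :
    Atom ≃ (ℕ × Event × Intv × ℕ × Event) ⊕ (ℕ × Event × Intv × ℕ) ⊕ (ℕ × Intv × ℕ × Event) where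
  toFun
    | .interval o₁ e₁ I o₂ e₂ => .inl (o₁, e₁, I, o₂, e₂)
    | .before o e I n => .inr (.inl (o, e, I, n))
    | .after n I o e => .inr (.inr (n, I, o, e))
  invFun
    | .inl (o₁, e₁, I, o₂, e₂) => .interval o₁ e₁ I o₂ e₂
    | .inr (.inl (o, e, I, n)) => .before o e I n
    | .inr (.inr (n, I, o, e)) => .after n I o e
  left_inv a := by cases a <;> rfl
  right_inv a := by rcases a with _ | _ | _ <;> rfl

instance : Primcodable Atom := Primcodable.ofEquiv _ Atom.equiv

def Quantifier.equiv : Quantifier ≃ ℕ × ℕ × ℕ where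
  toFun q := (q.name, q.var, q.val)
  invFun p := ⟨p.1, p.2.1, p.2.2⟩
  left_inv _ := rfl
  right_inv _ := rfl

instance : Primcodable Quantifier := Primcodable.ofEquiv _ Quantifier.equiv

def ExStmt.equiv : ExStmt ≃ List Quantifier × List Atom where
  toFun E := (E.quants, E.atoms)
  invFun p := ⟨p.1, p.2⟩
  left_inv _ := rfl
  right_inv _ := rfl

instance : Primcodable ExStmt := Primcodable.ofEquiv _ ExStmt.equiv

def Rule.equiv : Rule ≃ Option Quantifier × List ExStmt where
  toFun R := (R.trigger, R.stmts)
  invFun p := ⟨p.1, p.2⟩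
  left_inv _ := rfl
  right_inv _ := rfl

instance : Primcodable Rule := Primcodable.ofEquiv _ Rule.equiv

def Domain.equiv : Domain ≃ List StateVar × List Rule where
  toFun P := (P.vars, P.rules)
  invFun p := ⟨p.1, p.2⟩
  left_inv _ := rfl
  right_inv _ := rfl

instance : Primcodable Domain := Primcodable.ofEquiv _ Domain.equiv

/-- The decision problem "given an instance `a` with `inst a`, does `p a` hold?" is decidable: some
algorithm (partial recursive function) halts on every instance with the correct answer. Nothing is
required of it on inputs that are not instances. -/
def DecidableOn {α : Type*} [Primcodable α] (inst p : α → Prop) : Prop :=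
  ∃ f : α →. Bool, Partrec f ∧ ∀ a, inst a → ∃ b ∈ f a, (b = true ↔ p a)

end TP

/-!
The halting problem is reduced to the planning problem. Under the future semantics a trigger rule
cannot look back, but its existential statements may use several tokens at once, and that is
enough to copy a stretch of the timeline exactly. With positive durations and with the closed
conditions "`o'` starts when `o` ends" and "`o'` starts one unit of time after `o`", a rule can demand
of the token at position `i` that the tokens at `i` and `i + 1` have copies one unit of time later,
and that these copies are adjacent. By induction, if the first token has its copy at position `m`,
then every token `i` has its copy at `i + m`: the number `m` of tokens per unit of time never changes.
So a plan is the same as a finite word with an arbitrary period `m`, in which local relations hold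
between the symbols at `i`, `i + 1`, `i + 2` and those at `i + m`, `i + m + 1` (`HasPeriodicWord`,
`hasPeriodicWord_of_hasFuturePlan`, `hasFuturePlan_of_hasPeriodicWord`). Only intervals of the forms
`]0, ∞[`, `[0, 0]`, `[0, 1]` and `[1, ∞[` are needed, and a single state variable.

Such a word is read as a space-time diagram, whose rows of length `m` are the successive
configurations of a one-sided cellular automaton. A halting computation uses only finitely many cells,
so it fits into rows of a suitable length, while in the other direction walls between the rows
make sure that no information is lost at the right end. The word may end only after a halting cell,
and since plans are finite, it has to (`exists_halting_of_hasPeriodicWord`,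
`hasPeriodicWord_of_exists_halting`).

The automaton simulates a Turing machine whose two-sided tape is folded at the origin
(`exists_automaton_halting_undecidable`). The machine is a fixed one, obtained from Mathlib's
compilation of partial recursive functions into Turing machines and applied to a universal function
(`exists_machine_halting_undecidable`). Hence only the input varies. It is taken of the form `2 ^ n`,
whose binary expansion gives an initial tape `p q rⁿ`, so that the map from `n` to the domain is
easily seen to be primitive recursive (`primrec_wordDomain`).
-/

/-! ### A fixed finite Turing machine with undecidable halting problem -/

namespace TP

open Turing

instance : Fintype PartrecToTM2.K' :=
  ⟨{.main, .rev, .aux, .stack}, fun k => by cases k <;> simp⟩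

theorem exists_partrec_halting_undecidable :
    ∃ g : ℕ →. ℕ, Nat.Partrec g ∧ ¬ ComputablePred fun n => (g (2 ^ n)).Dom := by
  let f : ℕ →. ℕ := fun n => Nat.Partrec.Code.eval (Denumerable.ofNat Nat.Partrec.Code n) 0
  have hf : Partrec f :=
    Nat.Partrec.Code.eval_part.comp (Computable.ofNat _) (Computable.const 0)
  have hpow : Primrec₂ ((· ^ ·) : ℕ → ℕ → ℕ) :=
    Primrec₂.unpaired'.1 Nat.Primrec.pow
  -- `g` recovers `n` from `2 ^ n` by unbounded search
  let g : ℕ →. ℕ := fun k =>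
    (Nat.rfind fun n => Part.some (decide (2 ^ n = k))).bind f
  have hg : Partrec g := by
    refine Partrec.bind (Partrec.rfind (p := fun k n => Part.some (decide (2 ^ n = k))) ?_)
      (hf.comp Computable.snd)
    have : Primrec₂ fun k n : ℕ => decide (2 ^ n = k) :=
      (Primrec.eq (α := ℕ)).decide.comp (hpow.comp (Primrec.const 2) Primrec.snd) Primrec.fst
    exact this.to_comp.partrec
  have hgf (n : ℕ) : g (2 ^ n) = f n := by
    have : (Nat.rfind fun m => Part.some (decide (2 ^ m = 2 ^ n))) = Part.some n := by
      refine Part.eq_some_iff.2 (Nat.mem_rfind.2 ⟨by simp, fun {m} hm => ?_⟩)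
      have : m ≠ n := hm.ne
      simpa using this
    simp only [g, this]
    exact Part.bind_some _ _
  refine ⟨g, Partrec.nat_iff.1 hg, fun h => ?_⟩
  simp only [hgf] at h
  refine ComputablePred.halting_problem 0 ?_
  have := ComputablePred.computable_iff.1 h
  obtain ⟨b, hb, hb'⟩ := this
  refine ComputablePred.computable_iff.2
    ⟨fun c => b (Encodable.encode c), hb.comp Computable.encode, ?_⟩
  funext c
  have := congrFun hb' (Encodable.encode c)
  simpa [f] using this

theorem trNat_two_pow (n : ℕ) :
    PartrecToTM2.trNat (2 ^ n) = List.replicate n .bit0 ++ [.bit1] := by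
  have key (n : ℕ) : ∃ p : PosNum, ((2 ^ n : ℕ) : Num) = .pos p ∧
      PartrecToTM2.trPosNum p = List.replicate n .bit0 ++ [.bit1] := by
    induction n with
    | zero => exact ⟨1, rfl, rfl⟩
    | succ n ih =>
      obtain ⟨p, hp, hp'⟩ := ih
      refine ⟨p.bit0, ?_, ?_⟩
      · rw [pow_succ, mul_two, Nat.cast_add, hp, Num.bit0_of_bit0]
        rfl
      · simp [PartrecToTM2.trPosNum, hp', List.replicate_succ]
  obtain ⟨p, hp, hp'⟩ := key n
  rw [PartrecToTM2.trNat, hp]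
  exact hp'

/-- When a stack machine whose main stack holds the list `[2 ^ n]` is emulated on one tape, the
initial word on this tape is of the form `p q rⁿ`. -/
theorem exists_trInit_two_pow :
    ∃ p q r, ∀ n, TM2to1.trInit (Γ := fun _ : PartrecToTM2.K' => PartrecToTM2.Γ')
      PartrecToTM2.K'.main (PartrecToTM2.trList [2 ^ n]) = p :: q :: List.replicate n r := by
  refine ⟨(true, Function.update (fun _ => none) .main (some .cons)),
    (false, Function.update (fun _ => none) .main (some .bit1)),
    (false, Function.update (fun _ => none) .main (some .bit0)), fun n => ?_⟩
  have h : (PartrecToTM2.trList [2 ^ n]).reverse =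
      .cons :: .bit1 :: List.replicate n .bit0 := by
    simp [PartrecToTM2.trList, trNat_two_pow]
  simp only [TM2to1.trInit, h]
  exact congrArg (fun l => _ :: _ :: l) List.map_replicate

/-- A Turing machine with finitely many states, for which it is undecidable whether the machine
halts on an input of the form `p q rⁿ`. -/
theorem exists_machine_halting_undecidable :
    ∃ (Γ Q : Type) (_ : Inhabited Γ) (_ : Inhabited Q) (_ : Finite Γ) (_ : Finite Q)
      (M : TM0.Machine Γ Q) (p q r : Γ),
      ¬ ComputablePred fun n : ℕ =>
        (StateTransition.eval (TM0.step M) (TM0.init (p :: q :: List.replicate n r))).Dom := by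
  classical
  obtain ⟨g, hg, hund⟩ := exists_partrec_halting_undecidable
  obtain ⟨c, hc⟩ := ToPartrec.Code.exists_code (n := 1) (f := fun v => g v.head)
    (Nat.Partrec'.part_iff₁.2 (Partrec.nat_iff.2 hg))
  let _ : Inhabited PartrecToTM2.Λ' := ⟨PartrecToTM2.trNormal c .halt⟩
  let M₁ := TM2to1.tr PartrecToTM2.tr
  let M₀ := TM1to0.tr M₁
  have hS := TM1to0.tr_supports M₁
    (TM2to1.tr_supports PartrecToTM2.tr (PartrecToTM2.tr_supports c .halt))
  set S := TM1to0.trStmts M₁ (TM2to1.trSupp PartrecToTM2.tr (PartrecToTM2.codeSupp c .halt))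
  let _ : Inhabited S := ⟨⟨default, hS.1⟩⟩
  let toS : PointedMap (TM1to0.Λ' M₁) S :=
    ⟨fun a => if h : a ∈ S then ⟨a, h⟩ else default, by
      rw [dif_pos (by exact hS.1)]; rfl⟩
  let idΓ : PointedMap (TM2to1.Γ' PartrecToTM2.K' fun _ => PartrecToTM2.Γ')
    (TM2to1.Γ' PartrecToTM2.K' fun _ => PartrecToTM2.Γ') := ⟨id, rfl⟩
  obtain ⟨p, q, r, hpqr⟩ := exists_trInit_two_pow
  let M := M₀.map idΓ idΓ toS Subtype.val
  refine ⟨_, S, inferInstance, inferInstance, inferInstance, inferInstance, M,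
    p, q, r, fun h => hund (h.of_eq fun n => ?_)⟩
  rw [← hpqr]
  set w := TM2to1.trInit (Γ := fun _ : PartrecToTM2.K' => PartrecToTM2.Γ') PartrecToTM2.K'.main
        (PartrecToTM2.trList [2 ^ n]) with hw
  have h₀ : (StateTransition.eval (TM0.step M) (TM0.init w)).Dom ↔
      (StateTransition.eval (TM0.step M₀) (TM0.init w)).Dom := by
    refine StateTransition.tr_eval_dom
      (TM0.Machine.map_respects M₀ idΓ idΓ toS Subtype.val hS (fun _ => rfl) ?_) ⟨hS.1, ?_⟩
    · intro q hq
      exact congrArg Subtype.val (dif_pos hq)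
    · rw [TM0.map_init]
      congr 1
      exact List.map_id _
  have h₁ : (StateTransition.eval (TM0.step M₀) (TM0.init w)).Dom ↔ (TM1.eval M₁ w).Dom := by
    rw [← TM1to0.tr_eval]
    rfl
  have h₂ : (TM1.eval M₁ w).Dom ↔
      (StateTransition.eval (TM2.step PartrecToTM2.tr) (PartrecToTM2.init c [2 ^ n])).Dom := by
    rw [hw]
    refine (TM2to1.tr_eval_dom _ _ _).trans ?_
    have : (TM2.init PartrecToTM2.K'.main (PartrecToTM2.trList [2 ^ n]) :
        TM2.Cfg (fun _ : PartrecToTM2.K' => PartrecToTM2.Γ') PartrecToTM2.Λ'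
          (Option PartrecToTM2.Γ')) = PartrecToTM2.init c [2 ^ n] := by
      unfold TM2.init PartrecToTM2.init
      congr 1
      funext k
      cases k <;> rfl
    exact iff_of_eq (congrArg (fun c => (StateTransition.eval (TM2.step PartrecToTM2.tr) c).Dom) this)
  rw [h₀, h₁, h₂, PartrecToTM2.tr_eval]
  have := hc ⟨[2 ^ n], rfl⟩
  change (c.eval [2 ^ n]).Dom ↔ _
  rw [show c.eval [2 ^ n] = _ from this]
  rfl

/-! ### Turing machines as one-sided cellular automata -/

/-- One step of a one-sided cellular automaton of radius one with local rule `g`. The leftmost cell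
has no left neighbour, and the rule sees `none` in its place. -/
def evolve {A : Type*} (g : Option A → A → A → A) (D : ℕ → A) : ℕ → A
  | 0 => g none (D 0) (D 1)
  | x + 1 => g (some (D x)) (D (x + 1)) (D (x + 2))

section Cells

variable {Γ Q : Type*} [Inhabited Q] (M : TM0.Machine Γ Q)

/-- The new state of the head, if the head is in the cell `c` and leaves it in direction `d`. -/
def leaving (d : Dir) (c : Γ × Option Q) : Option Q :=
  c.2.bind fun q => match M q c.1 with
    | some (q', .move d') => if d' = d then some q' else none
    | _ => none

/-- The local rule of a Turing machine, on cells that hold a symbol and, where the head is, a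
state. A halted machine does not change. -/
def nextCell (l c r : Γ × Option Q) : Γ × Option Q :=
  match c.2 with
  | none => (c.1, leaving M .right l <|> leaving M .left r)
  | some q => match M q c.1 with
    | none => c
    | some (q', .write a) => (a, some q')
    | some (_, .move _) => (c.1, none)

/-- The head is in this cell, and the machine halts. -/
def HaltedCell (c : Γ × Option Q) : Prop :=
  ∃ q, c.2 = some q ∧ M q c.1 = none

/-- The local rule `nextCell` on a tape folded at the origin. -/
def foldedRule (l : Option ((Γ × Option Q) × (Γ × Option Q)))
    (c r : (Γ × Option Q) × (Γ × Option Q)) : (Γ × Option Q) × (Γ × Option Q) :=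
  match l with
  | none => (nextCell M c.2 c.1 r.1, nextCell M r.2 c.2 c.1)
  | some l => (nextCell M l.1 c.1 r.1, nextCell M r.2 c.2 l.2)

/-- Fold a two-sided sequence at the origin: position `x` holds the entries at `x` and `-1 - x`. -/
def fold {α : Type*} (C : ℤ → α) (x : ℕ) : α × α :=
  (C x, C (-1 - x))

theorem evolve_fold (C : ℤ → Γ × Option Q) :
    evolve (foldedRule M) (fold C) =
      fold fun z => nextCell M (C (z - 1)) (C z) (C (z + 1)) := by
  funext x
  cases x with
  | zero => simp [evolve, foldedRule, fold]
  | succ x =>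
    simp only [evolve, foldedRule, fold]
    refine Prod.ext ?_ ?_ <;> dsimp only <;> congr 2 <;> push_cast <;> ring

variable [Inhabited Γ]

/-- The cells of a configuration, with the head at the absolute position `h`. -/
def cells (c : TM0.Cfg Γ Q) (h z : ℤ) : Γ × Option Q :=
  (c.Tape.nth (z - h), if z = h then some c.q else none)

theorem nextCell_cells_of_step_eq_none {c : TM0.Cfg Γ Q} (hc : TM0.step M c = none) (h z : ℤ) :
    nextCell M (cells c h (z - 1)) (cells c h z) (cells c h (z + 1)) = cells c h z := by
  have hM : M c.q c.Tape.head = none := by simpa [TM0.step] using hc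
  have hl (d : Dir) (y : ℤ) : leaving M d (cells c h y) = none := by
    by_cases hy : y = h
    · simp [leaving, cells, hy, hM]
    · simp [leaving, cells, hy]
  by_cases hz : z = h
  · simp [nextCell, cells, hz, hM]
  · have : (cells c h z).2 = none := by simp [cells, hz]
    simp only [nextCell, this, hl]
    exact Prod.ext rfl this.symm

theorem exists_nextCell_cells_of_step_eq_some {c c' : TM0.Cfg Γ Q} (hc : TM0.step M c = some c')
    (h : ℤ) : ∃ h', ∀ z,
      nextCell M (cells c h (z - 1)) (cells c h z) (cells c h (z + 1)) = cells c' h' z := by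
  obtain ⟨q, T⟩ := c
  obtain ⟨⟨q', s⟩, hM, rfl⟩ : ∃ a, M q T.head = some a ∧ _ := by
    simpa only [TM0.step, Option.map_eq_some_iff] using hc
  rcases s with d | a
  · have hl (e : Dir) (y : ℤ) : leaving M e (cells ⟨q, T⟩ h y) =
        if y = h ∧ d = e then some q' else none := by
      by_cases hy : y = h
      · simp [leaving, cells, hM, hy]
      · simp [leaving, cells, hy]
    refine ⟨match d with | .left => h - 1 | .right => h + 1, fun z => ?_⟩
    by_cases hz : z = h
    · subst hz
      cases d <;> simp [nextCell, cells, hM]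
      omega
    · have hn : (cells ⟨q, T⟩ h z).2 = none := by simp [cells, hz]
      simp only [nextCell, hn, hl]
      cases d
      · have e₁ : z + 1 = h ↔ z = h - 1 := by omega
        have e₃ : z - (h - 1) - 1 = z - h := by omega
        simp [cells, e₁, e₃]
      · have e₁ : z - 1 = h ↔ z = h + 1 := by omega
        have e₃ : z - (h + 1) + 1 = z - h := by omega
        simp [cells, e₁, e₃]
  · refine ⟨h, fun z => ?_⟩
    by_cases hz : z = h
    · simp [nextCell, cells, hz, hM, Tape.write]
    · have hn : (cells ⟨q, T⟩ h z).2 = none := by simp [cells, hz]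
      have hl (e : Dir) (y : ℤ) : leaving M e (cells ⟨q, T⟩ h y) = none := by
        by_cases hy : y = h
        · simp [leaving, cells, hM, hy]
        · simp [leaving, cells, hy]
      simp only [nextCell, hn, hl]
      simp [cells, hz, sub_eq_zero]

/-- The automaton reaches a configuration with a halted cell iff the machine halts. -/
theorem exists_haltedCell_iff (c₀ : TM0.Cfg Γ Q) :
    (∃ t x, HaltedCell M ((evolve (foldedRule M))^[t] (fold (cells c₀ 0)) x).1 ∨
        HaltedCell M ((evolve (foldedRule M))^[t] (fold (cells c₀ 0)) x).2) ↔
      (StateTransition.eval (TM0.step M) c₀).Dom := by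
  constructor
  · rintro ⟨t, x, hx⟩
    have key : ∃ c h, StateTransition.Reaches (TM0.step M) c₀ c ∧
        (evolve (foldedRule M))^[t] (fold (cells c₀ 0)) = fold (cells c h) := by
      clear hx
      induction t with
      | zero => exact ⟨c₀, 0, Relation.ReflTransGen.refl, rfl⟩
      | succ t ih =>
        obtain ⟨c, h, hc, he⟩ := ih
        rw [Function.iterate_succ_apply', he, evolve_fold]
        cases hs : TM0.step M c with
        | none =>
          exact ⟨c, h, hc, congrArg fold (funext (nextCell_cells_of_step_eq_none M hs h))⟩
        | some c' =>
          obtain ⟨h', hh'⟩ := exists_nextCell_cells_of_step_eq_some M hs h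
          exact ⟨c', h', hc.tail hs, congrArg fold (funext hh')⟩
    obtain ⟨c, h, hc, he⟩ := key
    rw [he] at hx
    obtain ⟨z, q, hq, hM⟩ : ∃ z, HaltedCell M (cells c h z) := hx.elim (⟨_, ·⟩) (⟨_, ·⟩)
    have hz : z = h := by
      by_contra hz
      simp [cells, hz] at hq
    subst hz
    have hstep : TM0.step M c = none := by
      obtain ⟨q', T⟩ := c
      simp only [cells, sub_self, Tape.nth_zero, if_true, Option.some.injEq] at hq hM
      subst hq
      simp [TM0.step, hM]
    exact Part.dom_iff_mem.2 ⟨c, StateTransition.mem_eval.2 ⟨hc, hstep⟩⟩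
  · intro hd
    obtain ⟨c, hc⟩ := Part.dom_iff_mem.1 hd
    obtain ⟨hr, hstep⟩ := StateTransition.mem_eval.1 hc
    have key : ∃ t h, (evolve (foldedRule M))^[t] (fold (cells c₀ 0)) = fold (cells c h) := by
      clear hstep hd hc
      induction hr with
      | refl => exact ⟨0, 0, rfl⟩
      | tail _ hs ih =>
        obtain ⟨t, h, he⟩ := ih
        obtain ⟨h', hh'⟩ := exists_nextCell_cells_of_step_eq_some M hs h
        refine ⟨t + 1, h', ?_⟩
        rw [Function.iterate_succ_apply', he, evolve_fold]
        exact congrArg fold (funext hh')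
    obtain ⟨t, h, he⟩ := key
    have hcell : HaltedCell M (cells c h h) :=
      ⟨c.q, by simp [cells], by simpa [TM0.step, cells] using hstep⟩
    refine ⟨t, if 0 ≤ h then h.toNat else (-1 - h).toNat, ?_⟩
    rw [he]
    split_ifs with h0
    · left
      simpa [fold, h0] using hcell
    · right
      have : (-1 - ((-1 - h).toNat : ℤ)) = h := by omega
      simpa only [fold, this] using hcell

end Cells

/-- A one-sided cellular automaton on finitely many symbols, for which it is undecidable whether it
reaches a halting symbol from an initial configuration of the form `p q rⁿ b b b ⋯`. Halting symbols
persist, and the blank symbol `b` is quiescent. -/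
theorem exists_automaton_halting_undecidable :
    ∃ (A : Type) (_ : Finite A) (g : Option A → A → A → A) (halting : A → Prop) (b p q r : A),
      g (some b) b b = b ∧ (∀ l c s, halting c → halting (g l c s)) ∧
      ¬ ComputablePred fun n : ℕ =>
        ∃ t x, halting ((evolve g)^[t] (fun x => (p :: q :: List.replicate n r).getD x b) x) := by
  obtain ⟨Γ, Q, _, _, _, _, M, p, q, r, hund⟩ := exists_machine_halting_undecidable
  let bl : Γ × Option Q := (default, none)
  refine ⟨(Γ × Option Q) × (Γ × Option Q), inferInstance, foldedRule M,
    fun c => HaltedCell M c.1 ∨ HaltedCell M c.2, (bl, bl), ((p, some default), bl),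
    ((q, none), bl), ((r, none), bl), ?_, ?_, fun h => hund (h.of_eq fun n => ?_)⟩
  · simp [foldedRule, nextCell, leaving, bl]
  · have key (l c s : Γ × Option Q) (hc : HaltedCell M c) : HaltedCell M (nextCell M l c s) := by
      obtain ⟨q, hq, hM⟩ := hc
      exact ⟨q, by simp [nextCell, hq, hM], by simp [nextCell, hq, hM]⟩
    rintro (_ | l) c s (hc | hc)
    exacts [.inl (key _ _ _ hc), .inr (key _ _ _ hc), .inl (key _ _ _ hc), .inr (key _ _ _ hc)]
  · rw [← exists_haltedCell_iff]
    have : (fun x => ((((p, some default), bl) :: ((q, none), bl) ::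
        List.replicate n ((r, none), bl)).getD x (bl, bl))) =
        fold (cells (TM0.init (p :: q :: List.replicate n r) : TM0.Cfg Γ Q) 0) := by
      funext x
      have h₁ (x : ℕ) : (Tape.mk₁ (p :: q :: List.replicate n r)).nth x =
          (p :: q :: List.replicate n r).getI x := by
        rw [Tape.mk₁, Tape.mk₂, Tape.mk'_nth_nat, ListBlank.nth_mk]
      have h₂ (x : ℕ) : (Tape.mk₁ (p :: q :: List.replicate n r)).nth (-1 - x) = default := by
        rw [Tape.mk₁, Tape.mk₂, show (-1 - (x : ℤ)) = Int.negSucc x by omega]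
        exact ListBlank.nth_mk [] x
      have h₃ : (-1 - (x : ℤ)) ≠ 0 := by omega
      simp only [fold, cells, TM0.init, sub_zero, h₁, h₂, h₃, if_false]
      rcases x with _ | _ | x
      · simp [bl]
      · simp [bl]
      · simp only [List.getD_cons_succ, List.getI_cons_succ, bl]
        by_cases hx : x < n
        · rw [List.getD_eq_getElem _ _ (by simpa), List.getI_eq_getElem _ (by simpa)]
          simp
          omega
        · rw [List.getD_eq_default _ _ (by simpa using hx), List.getI_eq_default _ (by simpa using hx)]
          simp
          omega
    rw [this]

/-! ### Space-time diagrams as words -/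

/-- There is a word `v 0 ⋯ v (N - 1)` over `V` that starts with the first `len` symbols of `f`, whose
consecutive symbols are related by `next`, and that satisfies `R` for some period `m ≥ 1`: at each
position `i` whose symbol is not final, the symbols at `i`, `i + 1`, `i + 2` are related by `R` to
those at `i + m`, `i + m + 1`, and in particular these positions exist. -/
def HasPeriodicWord {V : Type*} (next : V → V → Prop) (final : V → Prop)
    (R : V → V → V → V → V → Prop) (len : ℕ) (f : ℕ → V) : Prop :=
  ∃ (N m : ℕ) (v : ℕ → V), 0 < N ∧ 0 < m ∧ len ≤ N ∧ (∀ i < len, v i = f i) ∧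
    (∀ i, i + 1 < N → next (v i) (v (i + 1))) ∧
    ∀ i < N, ¬ final (v i) →
      i + m + 1 < N ∧ R (v i) (v (i + 1)) (v (i + 2)) (v (i + m)) (v (i + m + 1))

/-- The symbols of the word that lists, row by row, the configurations of an automaton over `A`.
Each row starts with a wall; `wall₀` and `wall₁` are the walls of the rows `0` and `1`. The cells of
row `0` are `init a` or, beyond the input, `blank₀`, and those of the later rows are `cell a`. The
word may end with repetitions of `fin` after a halting cell. -/
inductive Letter (A : Type*)
  | wall₀
  | init (a : A)
  | blank₀
  | wall₁
  | wall
  | cell (a : A)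
  | fin

namespace Letter

variable {A : Type*}

instance [Finite A] : Finite (Letter A) :=
  Finite.of_injective
    (fun s : Letter A => (match s with
      | wall₀ => .inl 0
      | init a => .inr (.inl a)
      | blank₀ => .inl 1
      | wall₁ => .inl 2
      | wall => .inl 3
      | cell a => .inr (.inr a)
      | fin => .inl 4 : Fin 5 ⊕ A ⊕ A))
    (fun s t h => by cases s <;> cases t <;> simp_all)

/-- The state of the cell that a symbol stands for, where `b` is the blank state. -/
def state (b : A) : Letter A → Option A
  | init a => some a
  | cell a => some a
  | blank₀ => some b
  | _ => none

/-- The symbols that may follow a symbol. -/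
def Next (halting : A → Prop) : Letter A → Letter A → Prop
  | wall₀, init _ => True
  | init _, init _ => True
  | init _, blank₀ => True
  | blank₀, blank₀ => True
  | blank₀, wall₁ => True
  | wall₁, cell _ => True
  | wall, cell _ => True
  | cell _, cell _ => True
  | cell _, wall => True
  | cell a, fin => halting a
  | fin, fin => True
  | _, _ => False

/-- The relation between three consecutive symbols `s`, `c`, `u` and the symbols `s'`, `c'` one row
below `s`, `c`. A state follows the local rule `g`, with a blank in place of a missing right
neighbour. Below a wall there is a wall, and the blank cell on the right of the preceding row
would remain blank. -/
def Window (g : Option A → A → A → A) (b : A) (s c u s' c' : Letter A) : Prop :=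
  (s = wall₀ → s' = wall₁) ∧ (c' = fin ∨ match state b c with
    | some a => c' = cell (g (state b s) a ((state b u).getD b))
    | none => c' = wall ∧ ∃ l, state b s = some l ∧ g (some l) b b = b)

/-- The symbols of row `0` for the input `w`. -/
def firstRow (w : List A) : ℕ → Letter A
  | 0 => wall₀
  | x + 1 => match w[x]? with
    | some a => init a
    | none => blank₀

/-- The symbols that are allowed after `wall₁`. -/
def Late : Letter A → Prop
  | wall | cell _ | fin => True
  | _ => False

theorem Next.late {halting : A → Prop} {s s' : Letter A} (h : Next halting s s')
    (hs : s = wall₁ ∨ Late s) : Late s' := by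
  cases s <;> cases s' <;> simp_all [Next, Late]

theorem Next.eq_fin {halting : A → Prop} {s' : Letter A} (h : Next halting fin s') : s' = fin := by
  cases s' <;> simp_all [Next]

theorem state_firstRow_succ (b : A) (w : List A) (x : ℕ) :
    state b (firstRow w (x + 1)) = some (w.getD x b) := by
  simp only [firstRow, List.getD_eq_getElem?_getD]
  cases w[x]? <;> rfl

theorem firstRow_eq_blank₀ {w : List A} {x : ℕ} (h : w.length < x) : firstRow w x = blank₀ := by
  obtain _ | x := x
  · omega
  · simp only [firstRow, List.getElem?_eq_none (show w.length ≤ x by omega)]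

theorem firstRow_cases (w : List A) (x : ℕ) :
    firstRow w x = wall₀ ∨ (∃ a, firstRow w x = init a) ∨ firstRow w x = blank₀ := by
  obtain _ | x := x
  · exact .inl rfl
  · simp only [firstRow]
    cases w[x]? <;> simp

theorem next_firstRow {halting : A → Prop} {w : List A} (hw : w ≠ []) (x : ℕ) :
    Next halting (firstRow w x) (firstRow w (x + 1)) := by
  have hpos := List.length_pos_iff.2 hw
  obtain _ | x := x
  · simp [firstRow, List.getElem?_eq_getElem hpos, Next]
  · by_cases hx : x + 1 < w.length
    · simp [firstRow, List.getElem?_eq_getElem hx,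
        List.getElem?_eq_getElem (show x < w.length by omega), Next]
    · rw [firstRow_eq_blank₀ (x := x + 1 + 1) (by omega)]
      rcases firstRow_cases w (x + 1) with h | ⟨a, h⟩ | h
      · simp only [firstRow] at h
        cases h' : w[x]? <;> simp [h'] at h
      · simp [h, Next]
      · simp [h, Next]

end Letter

open Letter

section Automaton

variable {A : Type*} {g : Option A → A → A → A} {halting : A → Prop} {b : A} {w : List A}

theorem evolve_iterate_eq_blank (hb : g (some b) b b = b) (t x : ℕ) (hx : w.length + t ≤ x) :
    (evolve g)^[t] (fun x => w.getD x b) x = b := by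
  induction t generalizing x with
  | zero => exact List.getD_eq_default _ _ (by simpa using hx)
  | succ t ih =>
    rw [Function.iterate_succ_apply']
    obtain _ | x := x
    · omega
    · simp only [evolve]
      rw [ih x (by omega), ih (x + 1) (by omega), ih (x + 2) (by omega), hb]

/-- In a word of period `m`, the row of length `m` starting at position `t * m` lists the
configuration of the automaton at time `t`, up to the first `fin` in the word. -/
theorem exists_halting_of_hasPeriodicWord (hb : g (some b) b b = b)
    (h : HasPeriodicWord (Next halting) (· = fin) (Window g b) (w.length + 2) (firstRow w)) :
    ∃ t x, halting ((evolve g)^[t] (fun x => w.getD x b) x) := by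
  classical
  obtain ⟨N, m, v, hN, hm, hlen, hpre, hnext, hwin⟩ := h
  set D : ℕ → ℕ → A := fun t => (evolve g)^[t] (fun x => w.getD x b) with hD
  have hex : ∃ i, i < N ∧ v i = fin := by
    by_contra! hcon
    have := (hwin (N - 1) (by omega) (hcon _ (by omega))).1
    omega
  -- `r` is the first position of `fin`
  obtain ⟨r, ⟨hrN, hr⟩, hmin⟩ : ∃ r, (r < N ∧ v r = fin) ∧ ∀ i < r, v i ≠ fin :=
    ⟨Nat.find hex, Nat.find_spec hex, fun i hi hv =>
      Nat.find_min hex hi ⟨hi.trans (Nat.find_spec hex).1, hv⟩⟩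
  replace hwin (i : ℕ) (hi : i < r) := hwin i (by omega) (hmin i hi)
  have hv0 : v 0 = wall₀ := hpre 0 (by omega)
  have hr0 : 0 < r := by
    rcases Nat.eq_zero_or_pos r with h | h
    · simp [h, hv0] at hr
    · exact h
  obtain ⟨a, ha, hhalt⟩ : ∃ a, v (r - 1) = cell a ∧ halting a := by
    have h₁ := hnext (r - 1) (by omega)
    rw [Nat.sub_add_cancel hr0, hr] at h₁
    have h₂ := hmin (r - 1) (by omega)
    cases h : v (r - 1) <;> simp_all [Next]
  have hvm : v m = wall₁ := by simpa using (hwin 0 hr0).2.1 hv0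
  have hmN : m < N := by have := (hwin 0 hr0).1; omega
  have hfirst (x : ℕ) : firstRow w x ≠ wall₁ := by
    rcases firstRow_cases w x with h | ⟨a, h⟩ | h <;> simp [h]
  have hlenm : w.length + 2 ≤ m := by
    by_contra! hcon
    exact hfirst m ((hpre m hcon).symm.trans hvm)
  -- nothing but late symbols occur after `wall₁`, so it occurs only at position `m`
  have hlate (i : ℕ) (hi : v i = wall₁) (d : ℕ) (hd : i + d + 1 < N) : Late (v (i + d + 1)) := by
    induction d with
    | zero => exact (hnext i hd).late (.inl hi)
    | succ d ih => exact (hnext (i + d + 1) hd).late (.inr (ih (by omega)))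
  have hrow0 (i : ℕ) (hi : i < m) : v i = firstRow w i := by
    by_cases h : i < w.length + 2
    · exact hpre i h
    · obtain ⟨d, rfl⟩ : ∃ d, i = w.length + 1 + d := ⟨i - (w.length + 1), by omega⟩
      rw [firstRow_eq_blank₀ (by omega)]
      clear h
      induction d with
      | zero => rw [add_zero, hpre _ (by omega), firstRow_eq_blank₀ (by omega)]
      | succ d ih =>
        have h₁ := hnext (w.length + 1 + d) (by omega)
        rw [ih (by omega)] at h₁
        cases h : v (w.length + 1 + d + 1)
        case blank₀ => rfl
        case wall₁ =>
          have := hlate _ h (m - (w.length + 1 + d + 1) - 1) (by omega)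
          rw [show w.length + 1 + d + 1 + (m - (w.length + 1 + d + 1) - 1) + 1 = m by omega,
            hvm] at this
          exact this.elim
        all_goals simp [h, Next] at h₁
  have hDsucc (t x : ℕ) : D (t + 1) (x + 1) = g (some (D t x)) (D t (x + 1)) (D t (x + 2)) := by
    simp only [hD, Function.iterate_succ_apply']
    rfl
  have hDzero (t : ℕ) : D (t + 1) 0 = g none (D t 0) (D t 1) := by
    simp only [hD, Function.iterate_succ_apply']
    rfl
  have inv (t : ℕ) : (t * m < r → state b (v (t * m)) = none) ∧
      (∀ x, x + 1 < m → t * m + 1 + x < r → state b (v (t * m + 1 + x)) = some (D t x)) ∧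
      (t * m + m < r → state b (v (t * m + m)) = none ∧ ∀ x, m ≤ x + 1 → D t x = b) := by
    induction t with
    | zero =>
      refine ⟨fun _ => by simp [hv0, state], fun x hx _ => ?_, fun _ => ⟨?_, fun x hx => ?_⟩⟩
      · rw [zero_mul, zero_add, add_comm 1 x, hrow0 _ hx, state_firstRow_succ]
        rfl
      · simp [hvm, state]
      · exact evolve_iterate_eq_blank hb 0 x (by omega)
    | succ t ih =>
      obtain ⟨ih₁, ih₂, ih₃⟩ := ih
      have hmul : (t + 1) * m = t * m + m := Nat.succ_mul t m
      rw [hmul]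
      refine ⟨fun h => (ih₃ h).1, fun x hx hxr => ?_, fun h => ?_⟩
      · obtain ⟨-, -, hw⟩ := hwin (t * m + x) (by omega)
        rw [show t * m + x + m + 1 = t * m + m + 1 + x by omega,
          show t * m + x + 1 = t * m + 1 + x by omega, ih₂ x hx (by omega)] at hw
        rw [hw.resolve_left (hmin _ hxr)]
        have hright : (state b (v (t * m + x + 2))).getD b = D t (x + 1) := by
          by_cases hx' : x + 2 < m
          · rw [show t * m + x + 2 = t * m + 1 + (x + 1) by omega, ih₂ (x + 1) hx' (by omega)]
            rfl
          · rw [show t * m + x + 2 = t * m + m by omega, (ih₃ (by omega)).1,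
              (ih₃ (by omega)).2 (x + 1) (by omega)]
            rfl
        rw [hright]
        obtain _ | x := x
        · rw [add_zero, ih₁ (by omega), hDzero]
          rfl
        · rw [show t * m + (x + 1) = t * m + 1 + x by omega, ih₂ x (by omega) (by omega), hDsucc]
          rfl
      · obtain ⟨hwall, hblank⟩ := ih₃ (by omega)
        obtain ⟨-, -, hw⟩ := hwin (t * m + 1 + (m - 2)) (by omega)
        rw [show t * m + 1 + (m - 2) + 1 = t * m + m by omega,
          show t * m + 1 + (m - 2) + m + 1 = t * m + m + m by omega, hwall,
          ih₂ (m - 2) (by omega) (by omega)] at hw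
        obtain ⟨hw, l, hl, hgl⟩ := hw.resolve_left (hmin _ h)
        refine ⟨by rw [hw]; rfl, fun x hx => ?_⟩
        obtain ⟨x, rfl⟩ : ∃ y, x = y + 1 := ⟨x - 1, by omega⟩
        rw [hDsucc, hblank (x + 1) (by omega), hblank (x + 2) (by omega)]
        by_cases hx' : x = m - 2
        · rw [hx', hl, hgl]
        · rw [hblank x (by omega), hb]
  have hdiv : (r - 1) / m * m + (r - 1) % m = r - 1 := Nat.div_add_mod' _ _
  have hmod := Nat.mod_lt (r - 1) hm
  obtain ⟨h₁, h₂, -⟩ := inv ((r - 1) / m)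
  rcases Nat.eq_zero_or_pos ((r - 1) % m) with h0 | h0
  · rw [h0, add_zero] at hdiv
    rw [hdiv] at h₁
    simp [ha, state] at h₁
    omega
  · refine ⟨(r - 1) / m, (r - 1) % m - 1, ?_⟩
    have := h₂ ((r - 1) % m - 1) (by omega) (by omega)
    rw [show (r - 1) / m * m + 1 + ((r - 1) % m - 1) = r - 1 by omega, ha] at this
    rw [Option.some_injective _ this] at hhalt
    exact hhalt

/-- A row longer than the input by more than the duration of the computation never runs out of cells,
as the automaton changes at most one more cell on the right in each step. -/
theorem hasPeriodicWord_of_exists_halting (hb : g (some b) b b = b)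
    (hpersist : ∀ l c s, halting c → halting (g l c s)) (hw : w ≠ [])
    (h : ∃ t x, halting ((evolve g)^[t] (fun x => w.getD x b) x)) :
    HasPeriodicWord (Next halting) (· = fin) (Window g b) (w.length + 2) (firstRow w) := by
  obtain ⟨T, x₀, hx₀⟩ := h
  set D : ℕ → ℕ → A := fun t => (evolve g)^[t] (fun x => w.getD x b) with hD
  have hDsucc (t x : ℕ) : D (t + 1) (x + 1) = g (some (D t x)) (D t (x + 1)) (D t (x + 2)) := by
    simp only [hD, Function.iterate_succ_apply']
    rfl
  have hDzero (t : ℕ) : D (t + 1) 0 = g none (D t 0) (D t 1) := by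
    simp only [hD, Function.iterate_succ_apply']
    rfl
  -- a halting cell in row `0` persists in row `1`, where `fin` may follow it
  replace hx₀ : halting (D (T + 1) x₀) := by
    obtain _ | x₀ := x₀
    · rw [hDzero]; exact hpersist _ _ _ hx₀
    · rw [hDsucc]; exact hpersist _ _ _ hx₀
  obtain ⟨m, hm⟩ : ∃ m, m = w.length + T + x₀ + 4 := ⟨_, rfl⟩
  obtain ⟨r, hr⟩ : ∃ r, r = (T + 1) * m + x₀ + 2 := ⟨_, rfl⟩
  have hmul (t : ℕ) : (t + 1) * m = t * m + m := Nat.succ_mul t m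
  have hmr : m < r := by have := hmul T; omega
  let v : ℕ → Letter A := fun i =>
    if r ≤ i then fin
    else if i < m then firstRow w i
    else if i = m then wall₁
    else if i % m = 0 then wall
    else cell (D (i / m) (i % m - 1))
  have hvfin {i : ℕ} (hi : r ≤ i) : v i = fin := if_pos hi
  have hv0 {i : ℕ} (hi : i < m) : v i = firstRow w i := by
    simp only [v]
    rw [if_neg (by omega), if_pos hi]
  have hvm : v m = wall₁ := by
    simp only [v]
    rw [if_neg (by omega), if_neg (by omega)]
    exact if_pos trivial
  have hvwall (t : ℕ) (ht : (t + 1 + 1) * m < r) : v ((t + 1 + 1) * m) = wall := by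
    have := hmul t
    have := hmul (t + 1)
    simp only [v]
    rw [if_neg (by omega), if_neg (by omega), if_neg (by omega), if_pos (by simp)]
  have hvcell (t x : ℕ) (hx : x + 1 < m) (ht : (t + 1) * m + 1 + x < r) :
      v ((t + 1) * m + 1 + x) = cell (D (t + 1) x) := by
    have := hmul t
    have hmod : ((t + 1) * m + 1 + x) % m = x + 1 := by
      rw [add_assoc, Nat.mul_add_mod_self_right, add_comm, Nat.mod_eq_of_lt hx]
    have hdiv : ((t + 1) * m + 1 + x) / m = t + 1 := by
      rw [add_assoc, mul_comm, Nat.mul_add_div (by omega), Nat.div_eq_of_lt (by omega), add_zero]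
    simp only [v]
    rw [if_neg (by omega), if_neg (by omega), if_neg (by omega), if_neg (by omega), hmod, hdiv,
      Nat.add_sub_cancel]
  have hstate (t x : ℕ) (hx : x + 1 < m) (ht : t * m + 1 + x < r) :
      state b (v (t * m + 1 + x)) = some (D t x) := by
    obtain _ | t := t
    · rw [zero_mul, zero_add, add_comm, hv0 hx, state_firstRow_succ]
      rfl
    · rw [hvcell t x hx ht]
      rfl
  have hstate_wall (t : ℕ) (ht : t * m < r) : state b (v (t * m)) = none := by
    obtain _ | _ | t := t
    · rw [zero_mul, hv0 (by omega)]
      rfl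
    · rw [zero_add, one_mul, hvm]
      rfl
    · rw [hvwall t ht]
      rfl
  have hsplit (i : ℕ) : ∃ t y, i = t * m + y ∧ y < m :=
    ⟨i / m, i % m, (Nat.div_add_mod' _ _).symm, Nat.mod_lt _ (by omega)⟩
  refine ⟨r + m + 1, m, v, by omega, by omega, by omega, fun i hi => hv0 (by omega),
    fun i hi => ?_, fun i hi hvi => ?_⟩
  · by_cases h₁ : r ≤ i
    · rw [hvfin h₁, hvfin (by omega)]
      trivial
    by_cases h₂ : i + 1 = r
    · rw [hvfin (i := i + 1) (by omega), show i = (T + 1) * m + 1 + x₀ by omega,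
        hvcell T x₀ (by omega) (by omega)]
      exact hx₀
    by_cases h₃ : i + 1 < m
    · rw [hv0 h₃, hv0 (by omega)]
      exact next_firstRow hw i
    obtain ⟨t, y, rfl, hy⟩ := hsplit i
    by_cases h₄ : y + 1 = m
    · rw [add_assoc, h₄, ← hmul]
      obtain _ | t := t
      · rw [zero_mul, zero_add, zero_add, one_mul, hvm, hv0 hy, firstRow_eq_blank₀ (by omega)]
        trivial
      · have := hmul (t + 1)
        rw [hvwall t (by omega), show (t + 1) * m + y = (t + 1) * m + 1 + (y - 1) by omega,
          hvcell t (y - 1) (by omega) (by omega)]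
        trivial
    · obtain _ | t := t
      · omega
      rw [show (t + 1) * m + y + 1 = (t + 1) * m + 1 + y by omega,
        hvcell t y (by omega) (by omega)]
      obtain _ | y := y
      · rw [add_zero]
        obtain _ | t := t
        · rw [zero_add, one_mul, hvm]
          trivial
        · rw [hvwall t (by omega)]
          trivial
      · rw [show (t + 1) * m + (y + 1) = (t + 1) * m + 1 + y by omega,
          hvcell t y (by omega) (by omega)]
        trivial
  · have hir : i < r := by
      by_contra! hcon
      exact hvi (hvfin hcon)
    refine ⟨by omega, fun h => ?_, ?_⟩
    · have : i = 0 := by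
        by_contra hi0
        obtain ⟨t, y, rfl, hy⟩ := hsplit i
        obtain _ | y := y
        · obtain _ | _ | t := t
          · simp at hi0
          · simp [hvm] at h
          · simp [hvwall t hir] at h
        · have := hstate t y hy (by omega)
          rw [show t * m + 1 + y = t * m + (y + 1) by omega, h] at this
          simp [state] at this
      rw [this, zero_add, hvm]
    by_cases hr' : r ≤ i + m + 1
    · exact .inl (hvfin hr')
    obtain ⟨t, y, rfl, hy⟩ := hsplit i
    right
    by_cases hym : y + 1 = m
    · have h₁ := hmul t
      have h₂ := hmul (t + 1)
      have htT : t ≤ T := by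
        by_contra! hcon
        have := Nat.mul_le_mul_right m (show T + 1 ≤ t from hcon)
        omega
      rw [show t * m + y + 1 = (t + 1) * m by omega, hstate_wall _ (by omega),
        show t * m + y + m + 1 = (t + 1 + 1) * m by omega, hvwall t (by omega),
        show t * m + y = t * m + 1 + (y - 1) by omega, hstate t _ (by omega) (by omega)]
      refine ⟨rfl, _, rfl, ?_⟩
      rw [show D t (y - 1) = b from evolve_iterate_eq_blank hb _ _ (by omega), hb]
    · have h₁ := hmul t
      have htT : t ≤ T := by
        by_contra! hcon
        have := Nat.mul_le_mul_right m (show T + 1 ≤ t from hcon)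
        omega
      have hright : (state b (v (t * m + y + 2))).getD b = D t (y + 1) := by
        by_cases hy' : y + 2 < m
        · rw [show t * m + y + 2 = t * m + 1 + (y + 1) by omega,
            hstate t (y + 1) hy' (by omega)]
          rfl
        · rw [show t * m + y + 2 = (t + 1) * m by omega, hstate_wall _ (by omega)]
          exact (evolve_iterate_eq_blank hb _ _ (by omega)).symm
      rw [hright, show t * m + y + m + 1 = (t + 1) * m + 1 + y by omega,
        hvcell t y (by omega) (by omega), show t * m + y + 1 = t * m + 1 + y by omega,
        hstate t y (by omega) (by omega)]
      obtain _ | y := y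
      · rw [add_zero, hstate_wall t (by omega), hDzero]
      · rw [show t * m + (y + 1) = t * m + 1 + y by omega, hstate t y (by omega) (by omega), hDsucc]

end Automaton

/-! ### The domain of a periodic word problem -/

/-- The interval `]0, ∞[`. -/
def Intv.pos : Intv := ⟨0, false, none⟩

/-- The interval `[0, 0]`. -/
def Intv.zero : Intv := ⟨0, true, some (0, true)⟩

/-- The interval `[0, 1]`. -/
def Intv.leOne : Intv := ⟨0, true, some (1, true)⟩

/-- The interval `[1, ∞[`. -/
def Intv.geOne : Intv := ⟨1, true, none⟩

@[simp] theorem Intv.mem_pos {r : ℝ} : r ∈ Intv.pos.toSet ↔ 0 < r := by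
  simp [Intv.pos, Intv.toSet]

@[simp] theorem Intv.mem_zero {r : ℝ} : r ∈ Intv.zero.toSet ↔ r = 0 := by
  refine ⟨fun h => le_antisymm (by simpa using h.2 0 true rfl) (by simpa [Intv.zero] using h.1),
    fun h => ⟨by simp [Intv.zero, h], ?_⟩⟩
  rintro n c ⟨⟩
  simp [h]

@[simp] theorem Intv.mem_leOne {r : ℝ} : r ∈ Intv.leOne.toSet ↔ 0 ≤ r ∧ r ≤ 1 := by
  refine ⟨fun h => ⟨by simpa [Intv.leOne] using h.1, by simpa using h.2 1 true rfl⟩,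
    fun h => ⟨?_, ?_⟩⟩
  · simpa [Intv.leOne] using h.1
  · rintro n c ⟨⟩
    simpa using h.2

@[simp] theorem Intv.mem_geOne {r : ℝ} : r ∈ Intv.geOne.toSet ↔ 1 ≤ r := by
  simp [Intv.geOne, Intv.toSet]

@[simp] theorem Intv.mem_nonneg {r : ℝ} : r ∈ Intv.nonneg.toSet ↔ 0 ≤ r := by
  simp [Intv.nonneg, Intv.toSet]

/-- The token `o'` starts when the token `o` ends. -/
def Atom.meets (o o' : ℕ) : Atom := .interval o .finish .zero o' .start

/-- With `Atom.unitGE`, the token `o'` starts one unit of time after the token `o`. -/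
def Atom.unitLE (o o' : ℕ) : Atom := .interval o .start .leOne o' .start

/-- With `Atom.unitLE`, the token `o'` starts one unit of time after the token `o`. -/
def Atom.unitGE (o o' : ℕ) : Atom := .interval o .start .geOne o' .start

/-- The elements of a finite type that satisfy `p`, as a list. -/
noncomputable def enum {α : Type*} [Finite α] (p : α → Prop) : List α :=
  (Set.toFinite {x | p x}).toFinset.toList

@[simp] theorem mem_enum {α : Type*} [Finite α] {p : α → Prop} {x : α} : x ∈ enum p ↔ p x := by
  simp [enum]

/-- The timeline starts with tokens of the values `f 0, …, f (len - 1)`. -/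
def prefixRule (len : ℕ) (f : ℕ → ℕ) : Rule :=
  ⟨none, [⟨(List.range len).map fun i => ⟨i, 0, f i⟩,
    .before 0 .start .zero 0 :: (List.range (len - 1)).map fun i => .meets i (i + 1)⟩]⟩

/-- For the trigger `0` of some token, the tokens `1` and `2` are the next two ones, the tokens `3`
and `4` start one unit of time after `0` and `1`, and `4` follows `3` immediately. -/
def windowStmt (c u s' c' : ℕ) : ExStmt :=
  ⟨[⟨1, 0, c⟩, ⟨2, 0, u⟩, ⟨3, 0, s'⟩, ⟨4, 0, c'⟩],
    [.meets 0 1, .meets 1 2, .meets 3 4, .unitLE 0 3, .unitGE 0 3, .unitLE 1 4, .unitGE 1 4]⟩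

section WordDomain

variable {V : Type*} [Finite V] {k : ℕ} (e : V ≃ Fin k) (next : V → V → Prop) (final : V → Prop)
  (R : V → V → V → V → V → Prop)

/-- The rule with trigger value `s` that enforces the relation `R`. -/
noncomputable def windowRule (s : V) : Rule :=
  ⟨some ⟨0, 0, e s⟩, (enum fun x : V × V × V × V => R s x.1 x.2.1 x.2.2.1 x.2.2.2).map
    fun x => windowStmt (e x.1) (e x.2.1) (e x.2.2.1) (e x.2.2.2)⟩

/-- The state variable with the values `V`, coded by `e`, the transition relation `next` and
arbitrary positive durations. -/
noncomputable def wordVar : StateVar :=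
  ⟨List.replicate k .pos,
    (enum fun p : V × V => next p.1 p.2).map fun p => ((e p.1 : ℕ), (e p.2 : ℕ))⟩

/-- A domain whose future plans correspond to the words of `HasPeriodicWord`. -/
noncomputable def wordDomain (len : ℕ) (f : ℕ → ℕ) : Domain :=
  ⟨[wordVar e next], prefixRule len f :: (enum fun s => ¬ final s).map (windowRule e R)⟩

theorem intv_eq_of_hasIntv {len : ℕ} {f : ℕ → ℕ} {I : Intv}
    (hI : (wordDomain e next final R len f).HasIntv I) :
    I = .pos ∨ I = .zero ∨ I = .leOne ∨ I = .geOne := by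
  rcases hI with ⟨x, hx, hI⟩ | ⟨r, hr, E, hE, a, ha, rfl⟩
  · simp only [wordDomain, List.mem_singleton] at hx
    subst hx
    exact .inl (List.eq_of_mem_replicate hI)
  · right
    simp only [wordDomain, List.mem_cons, List.mem_map] at hr
    rcases hr with rfl | ⟨s, -, rfl⟩
    · simp only [prefixRule, List.mem_singleton] at hE
      subst hE
      simp only [List.mem_cons, List.mem_map] at ha
      rcases ha with rfl | ⟨i, -, rfl⟩ <;> exact .inl rfl
    · simp only [windowRule, List.mem_map] at hE
      obtain ⟨x, -, rfl⟩ := hE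
      simp only [windowStmt, List.mem_cons, List.not_mem_nil, or_false] at ha
      rcases ha with rfl | rfl | rfl | rfl | rfl | rfl | rfl <;>
        simp [Atom.meets, Atom.unitLE, Atom.unitGE, Atom.intv]

theorem wordDomain_isZeroInf {len : ℕ} {f : ℕ → ℕ} {I : Intv}
    (hI : (wordDomain e next final R len f).HasIntv I) : I.IsZeroInf := by
  rcases intv_eq_of_hasIntv e next final R hI with rfl | rfl | rfl | rfl <;>
    simp [Intv.IsZeroInf, Intv.pos, Intv.zero, Intv.leOne, Intv.geOne]

theorem wordDomain_wellFormed {len : ℕ} (hlen : 0 < len) {f : ℕ → ℕ} (hf : ∀ i, f i < k)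
    (hR : ∀ s, ¬ final s → ∃ c u s' c', R s c u s' c') :
    (wordDomain e next final R len f).WellFormed := by
  refine ⟨fun x hx => ?_, fun r hr => ?_, fun I hI => ?_⟩
  · simp only [wordDomain, List.mem_singleton] at hx
    subst hx
    intro p hp
    simp only [wordVar, List.mem_map] at hp
    obtain ⟨q, -, rfl⟩ := hp
    simp [wordVar]
  · have hq (o a : ℕ) (ha : a < k) : Quantifier.WellFormed [wordVar e next] ⟨o, 0, a⟩ :=
      ⟨_, rfl, by simpa [wordVar] using ha⟩
    simp only [wordDomain, List.mem_cons, List.mem_map, mem_enum] at hr ⊢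
    rcases hr with rfl | ⟨s, hs, rfl⟩
    · refine ⟨by simp [prefixRule], by simp [prefixRule], fun E hE => ?_⟩
      simp only [prefixRule, List.mem_singleton] at hE
      subst hE
      refine ⟨fun q hq' => ?_, fun o ho => ?_⟩
      · obtain ⟨i, -, rfl⟩ := List.mem_map.1 hq'
        exact hq _ _ (hf i)
      · exfalso
        obtain ⟨⟨a, ha, hoa⟩, ho⟩ := ho
        have ho : ¬ o < len := fun h => ho ⟨o, 0, f o⟩ (List.mem_map.2 ⟨o, by simpa, rfl⟩) rfl
        simp only [List.mem_cons, List.mem_map, List.mem_range] at ha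
        rcases ha with rfl | ⟨i, hi, rfl⟩ <;> simp [Atom.names, Atom.meets] at hoa <;> omega
    · refine ⟨fun q hq' => ?_, ?_, fun E hE => ?_⟩
      · simp only [windowRule, Option.some.injEq] at hq'
        subst hq'
        exact hq _ _ (e s).2
      · obtain ⟨c, u, s', c', h⟩ := hR s hs
        refine List.ne_nil_of_mem (List.mem_map.2 ⟨(c, u, s', c'), ?_, rfl⟩)
        simpa using h
      · simp only [windowRule, List.mem_map] at hE
        obtain ⟨x, -, rfl⟩ := hE
        refine ⟨fun q hq' => ?_, fun o ho => ⟨_, rfl, ?_⟩⟩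
        · simp only [windowStmt, List.mem_cons, List.not_mem_nil, or_false] at hq'
          rcases hq' with rfl | rfl | rfl | rfl <;> exact hq _ _ (Fin.is_lt _)
        · obtain ⟨⟨a, ha, hoa⟩, ho⟩ := ho
          simp only [windowStmt, List.mem_cons, List.not_mem_nil, or_false, forall_eq_or_imp,
            forall_eq] at ha ho
          rcases ha with rfl | rfl | rfl | rfl | rfl | rfl | rfl <;>
            simp [Atom.meets, Atom.unitLE, Atom.unitGE, Atom.names] at hoa <;>
            simp <;> omega
  · rcases intv_eq_of_hasIntv e next final R hI with rfl | rfl | rfl | rfl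
    exacts [⟨1, by simp⟩, ⟨0, by simp⟩, ⟨0, by simp⟩, ⟨1, by simp⟩]

end WordDomain

/-! ### Start times in a single timeline -/

theorem eventTime_start_succ (π : List Token) (i : ℕ) :
    eventTime π (i + 1) .start = eventTime π i .finish := rfl

theorem eventTime_start_strictMonoOn {π : List Token} (hπ : ∀ t ∈ π, 0 < t.dur) :
    StrictMonoOn (fun i => eventTime π i .start) (Set.Iic π.length) := by
  refine strictMonoOn_of_lt_succ Set.ordConnected_Iic fun i _ hi hi' => ?_
  have hi' : i < π.length := by simpa using hi'
  simp only [Nat.succ_eq_succ, eventTime]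
  have hpos := hπ _ (List.getElem_mem hi')
  rw [List.take_add_one, List.getElem?_eq_getElem hi', Option.toList_some, List.map_append,
    List.sum_append, List.map_singleton, List.sum_singleton]
  linarith

theorem eventTime_start_inj {π : List Token} (hπ : ∀ t ∈ π, 0 < t.dur) {i j : ℕ}
    (hi : i ≤ π.length) (hj : j ≤ π.length)
    (h : eventTime π i .start = eventTime π j .start) : i = j :=
  (eventTime_start_strictMonoOn hπ).injOn hi hj h

theorem Assignment.time_eq {M : Multi 1} (lam : Assignment M) (o : ℕ) (ev : Event) :
    lam.time o ev = eventTime (M 0) (lam o).2 ev :=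
  congrArg (fun j => eventTime (M j) (lam o).2 ev) (Subsingleton.elim _ 0)

theorem Assignment.getElem?_eq {M : Multi 1} (lam : Assignment M) (o : ℕ) :
    (M 0)[((lam o).2 : ℕ)]? = some ((M (lam o).1).get (lam o).2) := by
  have key (j : Fin 1) (i : Fin (M j).length) : (M 0)[(i : ℕ)]? = some ((M j).get i) := by
    obtain rfl : j = 0 := Subsingleton.elim _ _
    simp
  exact key _ _

theorem Assignment.index_lt {M : Multi 1} (lam : Assignment M) (o : ℕ) :
    ((lam o).2 : ℕ) < (M 0).length := by
  have := lam.getElem?_eq o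
  exact (List.getElem?_eq_some_iff.1 this).1

theorem Assignment.satAtom_meets_iff {M : Multi 1} (hM : ∀ t ∈ M 0, 0 < t.dur)
    (lam : Assignment M) (o o' : ℕ) :
    lam.SatAtom (.meets o o') ↔ ((lam o').2 : ℕ) = (lam o).2 + 1 := by
  simp only [SatAtom, Atom.meets, Intv.mem_zero, lam.time_eq, sub_eq_zero]
  rw [← eventTime_start_succ]
  refine ⟨fun h => eventTime_start_inj hM (lam.index_lt o').le (lam.index_lt o) h, fun h => ?_⟩
  rw [h]

theorem Assignment.satAtom_unit_iff {M : Multi 1} (lam : Assignment M) (o o' : ℕ) :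
    lam.SatAtom (.unitLE o o') ∧ lam.SatAtom (.unitGE o o') ↔
      eventTime (M 0) (lam o').2 .start = eventTime (M 0) (lam o).2 .start + 1 := by
  simp only [SatAtom, Atom.unitLE, Atom.unitGE, Intv.mem_leOne, Intv.mem_geOne, lam.time_eq]
  constructor
  · rintro ⟨⟨-, h₁⟩, h₂⟩
    linarith
  · intro h
    rw [h]
    norm_num

/-! ### Plans as periodic words -/

section WordDomain

variable {V : Type*} [Finite V] {k : ℕ} (e : V ≃ Fin k) {next : V → V → Prop} {final : V → Prop}
  {R : V → V → V → V → V → Prop}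

theorem satRule_prefixRule_iff {M : Multi 1} (hM : ∀ t ∈ M 0, 0 < t.dur) (hne : M 0 ≠ []) {len : ℕ}
    (hlen : 0 < len) (f : ℕ → ℕ) :
    SatRule M (prefixRule len f).future ↔
      len ≤ (M 0).length ∧ ∀ i < len, (M 0)[i]?.map Token.val = some (f i) := by
  have hpos := List.length_pos_iff.2 hne
  simp only [SatRule, Rule.future, prefixRule, List.mem_singleton, exists_eq_left,
    Assignment.SatStmt, List.forall_mem_map, List.forall_mem_cons, List.mem_range,
    Assignment.satAtom_meets_iff hM]
  have hstart (lam : Assignment M) :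
      lam.SatAtom (.before 0 .start .zero 0) ↔ ((lam 0).2 : ℕ) = 0 := by
    simp only [Assignment.SatAtom, Intv.mem_zero, lam.time_eq, Nat.cast_zero, zero_sub,
      neg_eq_zero]
    refine ⟨fun h => eventTime_start_inj hM (lam.index_lt 0).le (Nat.zero_le _) (h.trans ?_),
      fun h => ?_⟩
    · simp [eventTime]
    · rw [h]
      simp [eventTime]
  simp only [hstart]
  constructor
  · rintro ⟨lam, hq, h0, hmeet⟩
    have hidx (i : ℕ) (hi : i < len) : ((lam i).2 : ℕ) = i := by
      induction i with
      | zero => exact h0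
      | succ i ih => rw [hmeet i (by omega), ih (by omega)]
    refine ⟨?_, fun i hi => ?_⟩
    · have := lam.index_lt (len - 1)
      rw [hidx _ (by omega)] at this
      omega
    · have := lam.getElem?_eq i
      rw [hidx i hi] at this
      rw [this, Option.map_some, (hq i hi).2]
  · rintro ⟨hN, hv⟩
    refine ⟨fun o => ⟨0, if o < len then o else 0, by split_ifs <;> omega⟩, fun i hi => ⟨rfl, ?_⟩,
      by simp, fun i hi => ?_⟩
    · have := hv i hi
      rw [List.getElem?_eq_getElem (by omega), Option.map_some, Option.some.injEq] at this
      simpa [hi] using this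
    · simp [show i < len by omega, show i + 1 < len by omega]

/-- The atoms that encode the future semantics follow from those of the rule. -/
theorem satRule_windowRule_iff {M : Multi 1} (hM : ∀ t ∈ M 0, 0 < t.dur) (s : V) :
    SatRule M (windowRule e R s).future ↔ ∀ i, (M 0)[i]?.map Token.val = some ↑(e s) →
      ∃ j c u s' c', R s c u s' c' ∧
        (M 0)[i + 1]?.map Token.val = some ↑(e c) ∧ (M 0)[i + 2]?.map Token.val = some ↑(e u) ∧
        (M 0)[j]?.map Token.val = some ↑(e s') ∧ (M 0)[j + 1]?.map Token.val = some ↑(e c') ∧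
        eventTime (M 0) j .start = eventTime (M 0) i .start + 1 ∧
        eventTime (M 0) (j + 1) .start = eventTime (M 0) (i + 1) .start + 1 := by
  have hsat (lam : Assignment M) (c u s' c' : ℕ) :
      lam.SatStmt (ExStmt.future 0 (windowStmt c u s' c')) ↔
        ((M 0)[((lam 1).2 : ℕ)]?.map Token.val = some c ∧
        (M 0)[((lam 2).2 : ℕ)]?.map Token.val = some u ∧
        (M 0)[((lam 3).2 : ℕ)]?.map Token.val = some s' ∧
        (M 0)[((lam 4).2 : ℕ)]?.map Token.val = some c') ∧
        ((lam 1).2 : ℕ) = (lam 0).2 + 1 ∧ ((lam 2).2 : ℕ) = (lam 1).2 + 1 ∧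
        ((lam 4).2 : ℕ) = (lam 3).2 + 1 ∧
        eventTime (M 0) (lam 3).2 .start = eventTime (M 0) (lam 0).2 .start + 1 ∧
        eventTime (M 0) (lam 4).2 .start = eventTime (M 0) (lam 1).2 .start + 1 := by
    have hquant (o a : ℕ) :
        lam.SatQuant ⟨o, 0, a⟩ ↔ (M 0)[((lam o).2 : ℕ)]?.map Token.val = some a := by
      simp only [Assignment.SatQuant, lam.getElem?_eq, Option.map_some, Option.some.injEq,
        and_iff_right_iff_imp]
      intro _
      exact congrArg Fin.val (Subsingleton.elim _ (0 : Fin 1))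
    have hfut (o : ℕ) : lam.SatAtom (.interval 0 .start .nonneg o .start) ↔
        eventTime (M 0) (lam 0).2 .start ≤ eventTime (M 0) (lam o).2 .start := by
      simp only [Assignment.SatAtom, Intv.mem_nonneg, lam.time_eq, sub_nonneg]
    simp only [Assignment.SatStmt, ExStmt.future, windowStmt, List.forall_mem_cons,
      List.map_cons, List.map_nil, List.cons_append, List.nil_append, hquant, hfut,
      Assignment.satAtom_meets_iff hM, ← lam.satAtom_unit_iff, List.not_mem_nil, false_implies,
      implies_true, and_true]
    constructor
    · tauto
    · rintro ⟨hq, h₁, h₂, h₃, h₄, h₅⟩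
      have h₄' := (lam.satAtom_unit_iff _ _).1 h₄
      have h₅' := (lam.satAtom_unit_iff _ _).1 h₅
      have hle {i j : ℕ} (h : i ≤ j) (hj : j < (M 0).length) :
          eventTime (M 0) i .start ≤ eventTime (M 0) j .start :=
        (eventTime_start_strictMonoOn hM).monotoneOn (h.trans hj.le) hj.le h
      have h01 := hle (i := (lam 0).2) (j := (lam 1).2) (by omega) (lam.index_lt 1)
      have h02 := hle (i := (lam 0).2) (j := (lam 2).2) (by omega) (lam.index_lt 2)
      exact ⟨hq, h₁, h₂, h₃, h₄.1, h₄.2, h₅.1, h₅.2, h01, h02, by linarith, by linarith⟩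
  simp only [SatRule, Rule.future, windowRule, List.map_map, List.mem_map, mem_enum,
    Function.comp_apply]
  constructor
  · intro h i hi
    obtain ⟨t, ht, hts⟩ := Option.map_eq_some_iff.1 hi
    obtain ⟨hiN, rfl⟩ := List.getElem?_eq_some_iff.1 ht
    obtain ⟨E, ⟨x, hx, rfl⟩, lam, hlam, hE⟩ := h 0 ⟨i, hiN⟩ rfl hts
    obtain ⟨⟨hv₁, hv₂, hv₃, hv₄⟩, h₁, h₂, h₃, h₄, h₅⟩ := (hsat _ _ _ _ _).1 hE
    have h0 : ((lam 0).2 : ℕ) = i := by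
      rw [hlam]
    rw [h0] at h₁ h₄
    rw [h₁] at h₂ h₅ hv₁
    rw [h₂] at hv₂
    rw [h₃] at hv₄ h₅
    exact ⟨(lam 3).2, x.1, x.2.1, x.2.2.1, x.2.2.2, hx, hv₁, hv₂, hv₃, hv₄, h₄, h₅⟩
  · intro h j i _ hi
    obtain rfl : j = 0 := Subsingleton.elim _ _
    obtain ⟨j, c, u, s', c', hR, hv₁, hv₂, hv₃, hv₄, h₄, h₅⟩ := h i (by simpa using hi)
    have hlt {i a : ℕ} (h : (M 0)[i]?.map Token.val = some a) : i < (M 0).length := by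
      obtain ⟨t, ht, -⟩ := Option.map_eq_some_iff.1 h
      exact (List.getElem?_eq_some_iff.1 ht).1
    refine ⟨_, ⟨(c, u, s', c'), hR, rfl⟩,
      fun o => ⟨0, match o with
        | 0 => i
        | 1 => ⟨i + 1, hlt hv₁⟩
        | 2 => ⟨i + 2, hlt hv₂⟩
        | 3 => ⟨j, hlt hv₃⟩
        | _ => ⟨j + 1, hlt hv₄⟩⟩, rfl, ?_⟩
    exact (hsat _ _ _ _ _).2 ⟨⟨hv₁, hv₂, hv₃, hv₄⟩, rfl, rfl, rfl, h₄, h₅⟩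

theorem isToken_wordVar_iff (t : Token) :
    (wordVar e next).IsToken t ↔ t.val < k ∧ 0 < t.dur := by
  simp only [StateVar.IsToken, wordVar, List.getElem?_replicate]
  split_ifs with h <;> simp [h]

theorem mem_trans_wordVar_iff (a b : V) :
    ((e a : ℕ), (e b : ℕ)) ∈ (wordVar e next).trans ↔ next a b := by
  simp only [wordVar, List.mem_map, mem_enum, Prod.mk.injEq, Prod.exists]
  constructor
  · rintro ⟨a', b', h, ha, hb⟩
    rwa [← e.injective (Fin.ext ha), ← e.injective (Fin.ext hb)]
  · exact fun h => ⟨a, b, h, rfl, rfl⟩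

/-- All copies are shifted by the same number of positions, by induction on the position: copies of
adjacent tokens are adjacent, and tokens of positive duration are determined by their start times. -/
theorem hasPeriodicWord_of_hasFuturePlan (hfinal : ∀ a b, next a b → final a → final b) {len : ℕ}
    (hlen : 0 < len) (f : ℕ → V)
    (h : (wordDomain e next final R len fun i => e (f i)).HasFuturePlan) :
    HasPeriodicWord next final R len f := by
  obtain ⟨M, hM, hrules⟩ := h
  change Multi 1 at M
  obtain ⟨hne, htok, htrans⟩ := hM (0 : Fin 1)
  change M 0 ≠ [] at hne
  change ∀ t ∈ M 0, (wordVar e next).IsToken t at htok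
  change (M 0).IsChain fun t t' => (t.val, t'.val) ∈ (wordVar e next).trans at htrans
  simp only [isToken_wordVar_iff] at htok
  have hdur (t) (ht : t ∈ M 0) : 0 < t.dur := (htok t ht).2
  simp only [wordDomain, List.forall_mem_cons, List.forall_mem_map, mem_enum] at hrules
  have hprefix := (satRule_prefixRule_iff hdur hne hlen _).1 hrules.1
  have hwindow (s : V) (hs : ¬ final s) := (satRule_windowRule_iff e hdur s).1 (hrules.2 s hs)
  -- `v i` is the value of the `i`-th token
  have hex (i : ℕ) : ∃ a : V, ∀ t, (M 0)[i]? = some t → t.val = e a := by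
    by_cases hi : i < (M 0).length
    · refine ⟨e.symm ⟨((M 0)[i]).val, (htok _ (List.getElem_mem hi)).1⟩, fun t ht => ?_⟩
      rw [List.getElem?_eq_getElem hi, Option.some.injEq] at ht
      simp [ht]
    · refine ⟨f 0, fun t ht => absurd ht ?_⟩
      simp [List.getElem?_eq_none (not_lt.1 hi)]
  choose v hv using hex
  have hval (i : ℕ) (hi : i < (M 0).length) : (M 0)[i]?.map Token.val = some ↑(e (v i)) := by
    rw [List.getElem?_eq_getElem hi, Option.map_some, hv i _ (List.getElem?_eq_getElem hi)]
  have hval' {i : ℕ} {a : V} (h : (M 0)[i]?.map Token.val = some ↑(e a)) :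
      i < (M 0).length ∧ v i = a := by
    obtain ⟨t, ht, hta⟩ := Option.map_eq_some_iff.1 h
    refine ⟨(List.getElem?_eq_some_iff.1 ht).1, e.injective (Fin.ext ?_)⟩
    rw [← hv i t ht, hta]
  have hnext (i : ℕ) (hi : i + 1 < (M 0).length) : next (v i) (v (i + 1)) := by
    have := List.isChain_iff_getElem.1 htrans i hi
    rwa [hv i _ (List.getElem?_eq_getElem (by omega)), hv (i + 1) _ (List.getElem?_eq_getElem hi),
      mem_trans_wordVar_iff] at this
  have hwin (i : ℕ) (hi : i < (M 0).length) (hvi : ¬ final (v i)) : ∃ j, j + 1 < (M 0).length ∧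
      i + 1 < (M 0).length ∧ R (v i) (v (i + 1)) (v (i + 2)) (v j) (v (j + 1)) ∧
        eventTime (M 0) j .start = eventTime (M 0) i .start + 1 ∧
        eventTime (M 0) (j + 1) .start = eventTime (M 0) (i + 1) .start + 1 := by
    obtain ⟨j, c, u, s', c', hR, h₁, h₂, h₃, h₄, h₅, h₆⟩ := hwindow _ hvi i (hval i hi)
    obtain ⟨h₁', rfl⟩ := hval' h₁
    obtain ⟨-, rfl⟩ := hval' h₂
    obtain ⟨-, rfl⟩ := hval' h₃
    obtain ⟨h₄', rfl⟩ := hval' h₄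
    exact ⟨j, h₄', h₁', hR, h₅, h₆⟩
  have hNpos := List.length_pos_iff.2 hne
  have hpre (i : ℕ) (hi : i < len) : v i = f i := (hval' (hprefix.2 i hi)).2
  by_cases h0 : final (v 0)
  · have hall (i : ℕ) (hi : i < (M 0).length) : final (v i) := by
      induction i with
      | zero => exact h0
      | succ i ih => exact hfinal _ _ (hnext i hi) (ih (by omega))
    exact ⟨(M 0).length, 1, v, hNpos, one_pos, hprefix.1, hpre, hnext,
      fun i hi hvi => absurd (hall i hi) hvi⟩
  · -- the token one unit of time after the first one determines the period
    obtain ⟨m, hmN, -, -, hm, -⟩ := hwin 0 hNpos h0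
    have hm0 : 0 < m := by
      rcases Nat.eq_zero_or_pos m with rfl | h
      · simp at hm
      · exact h
    refine ⟨(M 0).length, m, v, hNpos, hm0, hprefix.1, hpre, hnext, ?_⟩
    have key (i : ℕ) (hi : i < (M 0).length) (hvi : ¬ final (v i)) : i + m < (M 0).length ∧
        eventTime (M 0) (i + m) .start = eventTime (M 0) i .start + 1 := by
      induction i with
      | zero => exact ⟨by omega, by rw [zero_add, hm]⟩
      | succ i ih =>
        have hvi' : ¬ final (v i) := fun h => hvi (hfinal _ _ (hnext i hi) h)
        obtain ⟨h₁, h₂⟩ := ih (by omega) hvi'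
        obtain ⟨j, hj, -, -, hij, hij'⟩ := hwin i (by omega) hvi'
        obtain rfl := eventTime_start_inj hdur (by omega) h₁.le (hij.trans h₂.symm)
        rw [add_right_comm]
        exact ⟨hj, hij'⟩
    intro i hi hvi
    obtain ⟨j, hj, hi', hR, hij, -⟩ := hwin i hi hvi
    obtain ⟨h₁, h₂⟩ := key i hi hvi
    obtain rfl := eventTime_start_inj hdur (by omega) h₁.le (hij.trans h₂.symm)
    exact ⟨hj, hR⟩

/-- If all tokens have duration `1 / m`, a shift by `m` positions is a shift by one unit of time. -/
theorem hasFuturePlan_of_hasPeriodicWord {len : ℕ} (hlen : 0 < len) (f : ℕ → V)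
    (h : HasPeriodicWord next final R len f) :
    (wordDomain e next final R len fun i => e (f i)).HasFuturePlan := by
  obtain ⟨N, m, v, hN, hm, hlenN, hpre, hnext, hwin⟩ := h
  let π : List Token := (List.range N).map fun i => ⟨e (v i), 1 / m⟩
  have hm' : (0 : ℝ) < 1 / m := by positivity
  have hπ (t) (ht : t ∈ π) : 0 < t.dur := by
    obtain ⟨i, -, rfl⟩ := List.mem_map.1 ht
    exact hm'
  have hlength : π.length = N := by simp [π]
  have hne : π ≠ [] := List.length_pos_iff.1 (by omega)
  have hval {i : ℕ} (hi : i < N) : π[i]?.map Token.val = some ↑(e (v i)) := by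
    simp [π, List.getElem?_range hi]
  have htime {i : ℕ} (hi : i ≤ N) : eventTime π i .start = i / m := by
    simp only [eventTime, π, ← List.map_take, List.map_map, List.take_range, Nat.min_eq_left hi]
    simp [Function.comp_def, div_eq_mul_inv]
  have hm0 : (m : ℝ) ≠ 0 := by positivity
  refine ⟨fun _ => π, fun j => ?_, ?_⟩
  · obtain rfl : j = (0 : Fin 1) := Subsingleton.elim (α := Fin 1) _ _
    change (wordVar e next).IsTimeline π
    refine ⟨hne, fun t ht => ?_, List.isChain_iff_getElem.2 fun i hi => ?_⟩
    · rw [isToken_wordVar_iff]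
      refine ⟨?_, hπ t ht⟩
      obtain ⟨i, -, rfl⟩ := List.mem_map.1 ht
      exact (e (v i)).2
    · have := hnext i (by omega)
      simpa [π, mem_trans_wordVar_iff] using this
  · simp only [wordDomain, List.forall_mem_cons, List.forall_mem_map, mem_enum]
    refine ⟨(satRule_prefixRule_iff (M := fun _ => π) hπ hne hlen _).2 ⟨by omega, fun i hi => ?_⟩,
      fun s hs => (satRule_windowRule_iff (M := fun _ => π) e hπ s).2 fun i hi => ?_⟩
    · rw [← hpre i hi]
      exact hval (by omega)
    · obtain ⟨t, ht, hts⟩ := Option.map_eq_some_iff.1 hi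
      have hiN : i < N := hlength ▸ (List.getElem?_eq_some_iff.1 ht).1
      have : v i = s := e.injective (Fin.ext (Option.some_injective _ ((hval hiN).symm.trans hi)))
      subst this
      obtain ⟨hN', hR⟩ := hwin i hiN hs
      refine ⟨i + m, _, _, _, _, hR, hval (by omega), hval (by omega), hval (by omega),
        hval (by omega), ?_, ?_⟩
      · rw [htime (by omega), htime (by omega)]
        push_cast
        field_simp
      · rw [htime (by omega), htime (by omega)]
        push_cast
        field_simp
        ring

end WordDomain

/-! ### Computability of the reduction -/

open Primrec in
/-- In a family of word domains of which only the prefix depends on the input `n`, the domain is a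
primitive recursive function of `n`. -/
theorem primrec_wordDomain {V : Type*} [Finite V] {k : ℕ} (e : V ≃ Fin k) (next : V → V → Prop)
    (final : V → Prop) (R : V → V → V → V → V → Prop) {len : ℕ → ℕ} {f : ℕ → ℕ → ℕ}
    (hlen : Primrec len) (hf : Primrec₂ f) :
    Primrec fun n => wordDomain e next final R (len n) (f n) := by
  have hmeets : Primrec fun i : ℕ => Atom.meets i (i + 1) := by
    refine Primrec.of_eq ((Primrec.of_equiv_symm (e := Atom.equiv)).comp
      (sumInl.comp (Primrec.pair Primrec.id (Primrec.pair (const Event.finish)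
        (Primrec.pair (const Intv.zero) (Primrec.pair Primrec.succ (const Event.start))))))) ?_
    exact fun i => rfl
  have hquant : Primrec₂ fun n i : ℕ => (⟨i, 0, f n i⟩ : Quantifier) := by
    refine Primrec₂.of_eq ((Primrec.of_equiv_symm (e := Quantifier.equiv)).comp₂
      (Primrec₂.pair.comp₂ Primrec₂.right (Primrec₂.pair.comp₂ (Primrec₂.const 0) hf))) ?_
    exact fun n i => rfl
  have hquants : Primrec fun n => (List.range (len n)).map fun i => (⟨i, 0, f n i⟩ : Quantifier) :=
    list_map (list_range.comp hlen) hquant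
  have hatoms : Primrec fun n => Atom.before 0 .start .zero 0 ::
      (List.range (len n - 1)).map fun i => Atom.meets i (i + 1) :=
    list_cons.comp (const _)
      (list_map (list_range.comp (pred.comp hlen)) (hmeets.comp₂ Primrec₂.right))
  have hstmt : Primrec fun n => (⟨(List.range (len n)).map fun i => ⟨i, 0, f n i⟩,
      .before 0 .start .zero 0 :: (List.range (len n - 1)).map fun i => .meets i (i + 1)⟩ :
        ExStmt) :=
    Primrec.of_eq ((Primrec.of_equiv_symm (e := ExStmt.equiv)).comp (hquants.pair hatoms))
      fun n => rfl
  have hrule : Primrec fun n => prefixRule (len n) (f n) :=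
    Primrec.of_eq ((Primrec.of_equiv_symm (e := Rule.equiv)).comp
      ((const none).pair (list_cons.comp hstmt (const [])))) fun n => rfl
  exact Primrec.of_eq ((Primrec.of_equiv_symm (e := Domain.equiv)).comp
    ((const [wordVar e next]).pair
      (list_cons.comp hrule (const ((enum fun s => ¬ final s).map (windowRule e R))))))
    fun n => rfl

theorem firstRow_cons_cons_replicate {A : Type*} (p q r : A) (n i : ℕ) :
    Letter.firstRow (p :: q :: List.replicate n r) i =
      if i = 0 then .wall₀ else if i = 1 then .init p else if i = 2 then .init q
      else if i < n + 3 then .init r else .blank₀ := by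
  obtain _ | _ | _ | i := i
  · rfl
  · rfl
  · rfl
  · simp only [Letter.firstRow, List.getElem?_cons_succ, List.getElem?_replicate]
    simp only [show i + 1 + 1 + 1 < n + 3 ↔ i < n by omega]
    split_ifs <;> first | omega | rfl

/-- Undecidability passes along a computable map whose values are instances. -/
theorem not_decidableOn_of_computable {α : Type*} [Primcodable α] {inst p : α → Prop} {P : ℕ → α}
    (hP : Computable P) (hinst : ∀ n, inst (P n)) (hp : ¬ ComputablePred fun n => p (P n)) :
    ¬ DecidableOn inst p := by
  rintro ⟨f, hf, h⟩
  choose b hb using fun n => h (P n) (hinst n)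
  have hcomp : Computable b := (hf.comp hP).of_eq_tot fun n => (hb n).1
  refine hp (ComputablePred.computable_iff.2 ⟨b, hcomp, ?_⟩)
  funext n
  exact propext (hb n).2.symm

theorem not_decidableOn_hasFuturePlan :
    ¬ DecidableOn
      (fun P : Domain => P.WellFormed ∧ P.vars.length = 1 ∧ ∀ I, P.HasIntv I → I.IsZeroInf)
      Domain.HasFuturePlan := by
  obtain ⟨A, _, g, halting, b, p, q, r, hb, hpersist, hund⟩ := exists_automaton_halting_undecidable
  obtain ⟨k, ⟨e⟩⟩ := Finite.exists_equiv_fin (Letter A)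
  let w : ℕ → List A := fun n => p :: q :: List.replicate n r
  let P : ℕ → Domain := fun n => wordDomain e (Letter.Next halting) (· = .fin) (Letter.Window g b)
    (n + 4) fun i => e (Letter.firstRow (w n) i)
  have hplan (n : ℕ) : (P n).HasFuturePlan ↔
      ∃ t x, halting ((evolve g)^[t] (fun x => (w n).getD x b) x) := by
    have hlen : (w n).length + 2 = n + 4 := by simp [w]
    constructor
    · intro h
      refine exists_halting_of_hasPeriodicWord hb ?_
      rw [hlen]
      refine hasPeriodicWord_of_hasFuturePlan e ?_ (by omega) _ h
      rintro s s' h rfl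
      exact h.eq_fin
    · intro h
      refine hasFuturePlan_of_hasPeriodicWord e (by omega) _ ?_
      rw [← hlen]
      exact hasPeriodicWord_of_exists_halting hb hpersist (by simp [w]) h
  have hcomp : Primrec P := by
    refine primrec_wordDomain e _ _ _ (Primrec.nat_add.comp .id (.const 4)) ?_
    have hlt : PrimrecPred fun x : ℕ × ℕ => x.2 < x.1 + 3 :=
      Primrec.nat_lt.comp Primrec.snd (Primrec.nat_add.comp Primrec.fst (.const 3))
    have heq (c : ℕ) : PrimrecPred fun x : ℕ × ℕ => x.2 = c :=
      Primrec.eq.comp Primrec.snd (.const c)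
    refine Primrec.of_eq (Primrec.ite (heq 0) (.const (e .wall₀ : ℕ)) <|
      Primrec.ite (heq 1) (.const (e (.init p) : ℕ)) <|
      Primrec.ite (heq 2) (.const (e (.init q) : ℕ)) <|
      Primrec.ite hlt (.const (e (.init r) : ℕ)) (.const (e .blank₀ : ℕ))) fun x => ?_
    simp only [w, firstRow_cons_cons_replicate]
    split_ifs <;> rfl
  refine not_decidableOn_of_computable (P := P) hcomp.to_comp
    (fun n => ⟨?_, rfl, fun I hI => wordDomain_isZeroInf e _ _ _ hI⟩) ?_
  · exact wordDomain_wellFormed e _ _ _ (by omega) (fun i => (e _).2)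
      fun s _ => ⟨.fin, .fin, .wall₁, .fin, fun _ => rfl, .inl rfl⟩
  · exact fun h => hund (h.of_eq hplan)

end TP

/-- The future planning problem is undecidable, and it remains so for domains that have exactly one
state variable and all of whose intervals are unbounded or left-closed with left endpoint `0`. -/
theorem theorem1 :
    ¬ TP.DecidableOn TP.Domain.WellFormed TP.Domain.HasFuturePlan ∧
    ¬ TP.DecidableOn
      (fun P : TP.Domain => P.WellFormed ∧ P.vars.length = 1 ∧ ∀ I, P.HasIntv I → I.IsZeroInf)
      TP.Domain.HasFuturePlan := by
  -- an algorithm for all well-formed domains would also solve the restricted problem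
  -- an algorithm for all well-formed domains would also solve the restricted problem
  -- an algorithm for all well-formed domains would also solve the restricted problem
  refine ⟨fun ⟨f, hf, h⟩ => ?_, TP.not_decidableOn_hasFuturePlan⟩
  exact TP.not_decidableOn_hasFuturePlan ⟨f, hf, fun P hP => h P hP.1⟩
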